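/- All graphs are finite and simple. A colored graph is a graph $X$ with a map $c\colon V(X)\to C$ to a set of colors (adjacent vertices may have the same color). Let $C(\mathrm{Qut}_c(X))$ be the universal unital $C^*$-algebra generated by elements $u_{ij}$ ($i,j\in V(X)$) subject to $$u_{ij}=u_{ij}^*=u_{ij}^2,\qquad \sum_k u_{ik}=1=\sum_k u_{kj},\qquad u_{ij}u_{kl}=0\ \text{ if } ik\in E(X),\ jl\notin E(X)\text{ or vice versa},\qquad u_{ij}=0\ \text{ if } c(i)\neq c(j).$$ The quantum automorphism group $\mathrm{Qut}_c(X)$ is the compact matrix quantum group given by this algebra, the fundamental representation $u=(u_{ij})$ and the comultiplication $\Delta(u_{ij})=\sum_k u_{ik}\otimes u_{kj}$ (with values in the minimal tensor product). Two compact quantum groups $\mathbb G,\mathbb H$ are isomorphic, $\mathbb G\cong\mathbb H$, if there is a $*$-isomorphism $\varphi\colon C(\mathbb G)\to C(\mathbb H)$ with $(\varphi\otimes\varphi)\circ\Delta_{\mathbb G}=\Delta_{\mathbb H}\circ\varphi$. The quantum orbits of $X$ are the classes of the equivalence relation $i\sim j\iff u_{ij}\neq 0$ on $V(X)$. **Lemma.**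 Let $X$ be a colored graph. 1. Let $S\subseteq V(X)$ be an independent set which is a union of color classes, and let $Y$ be obtained from $X$ by adding an edge between every pair of distinct vertices of $S$. Then $\mathrm{Qut}_c(X)\cong\mathrm{Qut}_c(Y)$. 2. Let $S,T\subseteq V(X)$ be disjoint sets, each a union of color classes, such that $S\cup T$ is an independent set, and let $Y$ be obtained from $X$ by adding an edge from every $s\in S$ to every $t\in T$. Then $\mathrm{Qut}_c(X)\cong\mathrm{Qut}_c(Y)$. 3. Let $S\subseteq V(X)$ be a monochromatic set which is a union of quantum orbits of $X$, and let $Y$ be obtained from $X$ by changing the color of all vertices of $S$ to a new color (one that does not occur outside $S$; the set of colors may be enlarged for this). Then $\mathrm{Qut}_c(X)\cong\mathrm{Qut}_c(Y)$. 4. Let $Y$ be obtained from $X$ by adding an isolated vertex in a new color (one that does not occur in $X$; the set of colors may be enlarged for this). Then $\mathrm{Qut}_c(X)\cong\mathrm{Qut}_c(Y)$. -/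

import Mathlib

open scoped TensorProduct ComplexOrder

noncomputable section

universe u v w

/-- A `C*`-seminorm on a unital complex `*`-algebra. -/
structure CStarSeminorm (D : Type u) [Ring D] [StarRing D] [Algebra ℂ D] extends
    Seminorm ℂ D where
  mul_le' : ∀ x y : D, toFun (x * y) ≤ toFun x * toFun y
  star_mul_self' : ∀ x : D, toFun (star x * x) = toFun x * toFun x

namespace CStarSeminorm

section basic

variable {D : Type u} [Ring D] [StarRing D] [Algebra ℂ D]

instance : CoeFun (CStarSeminorm D) (fun _ => D → ℝ) := ⟨fun p => p.toSeminorm⟩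

variable (p : CStarSeminorm D)

theorem nonneg (x : D) : 0 ≤ p x := apply_nonneg p.toSeminorm x

theorem mul_le (x y : D) : p (x * y) ≤ p x * p y := p.mul_le' x y

theorem star_mul_self (x : D) : p (star x * x) = p x * p x := p.star_mul_self' x

theorem le_star (x : D) : p x ≤ p (star x) := by
  have h := p.mul_le (star x) x
  rw [p.star_mul_self] at h
  rcases (p.nonneg x).eq_or_lt with h0 | h0
  · rw [← h0]; exact p.nonneg _
  · exact le_of_mul_le_mul_right h h0

theorem map_star (x : D) : p (star x) = p x :=
  le_antisymm (by simpa using p.le_star (star x)) (p.le_star x)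

/-- The pointwise supremum of a pointwise bounded set of `C*`-seminorms. -/
def sup (S : Set (CStarSeminorm D))
    (hS : ∀ x : D, BddAbove (Set.range fun p : S => (p : CStarSeminorm D) x)) :
    CStarSeminorm D where
  toFun x := ⨆ p : S, (p : CStarSeminorm D) x
  map_zero' := by simp
  add_le' x y := by
    have h0 (z : D) : 0 ≤ ⨆ p : S, (p : CStarSeminorm D) z :=
      Real.iSup_nonneg fun p => p.1.nonneg z
    refine Real.iSup_le (fun p => ?_) (add_nonneg (h0 x) (h0 y))
    exact (map_add_le_add p.1.toSeminorm x y).trans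
      (add_le_add (le_ciSup (hS x) p) (le_ciSup (hS y) p))
  neg' x := by simp
  smul' a x := by
    simp only [map_smul_eq_mul]
    rw [Real.mul_iSup_of_nonneg (norm_nonneg a)]
  mul_le' x y := by
    have h0 (z : D) : 0 ≤ ⨆ p : S, (p : CStarSeminorm D) z :=
      Real.iSup_nonneg fun p => p.1.nonneg z
    refine Real.iSup_le (fun p => ?_) (mul_nonneg (h0 x) (h0 y))
    exact (p.1.mul_le x y).trans
      (mul_le_mul (le_ciSup (hS x) p) (le_ciSup (hS y) p) (p.1.nonneg y) (h0 x))
  star_mul_self' x := by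
    have h0 (z : D) : 0 ≤ ⨆ p : S, (p : CStarSeminorm D) z :=
      Real.iSup_nonneg fun p => p.1.nonneg z
    refine le_antisymm (Real.iSup_le (fun p => ?_) (mul_nonneg (h0 x) (h0 x))) ?_
    · rw [p.1.star_mul_self]
      exact mul_le_mul (le_ciSup (hS x) p) (le_ciSup (hS x) p) (p.1.nonneg x) (h0 x)
    · rw [Real.mul_iSup_of_nonneg (h0 x)]
      refine Real.iSup_le (fun p => ?_) (h0 _)
      rw [Real.iSup_mul_of_nonneg (p.1.nonneg x)]
      refine Real.iSup_le (fun q => ?_) (h0 _)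
      rcases le_total (p.1 x) (q.1 x) with h | h
      · refine le_trans (mul_le_mul_of_nonneg_left h (q.1.nonneg x)) ?_
        rw [← q.1.star_mul_self]
        exact le_ciSup (hS (star x * x)) q
      · refine le_trans (mul_le_mul_of_nonneg_right h (p.1.nonneg x)) ?_
        rw [← p.1.star_mul_self]
        exact le_ciSup (hS (star x * x)) p

theorem le_sup {S : Set (CStarSeminorm D)}
    (hS : ∀ x : D, BddAbove (Set.range fun p : S => (p : CStarSeminorm D) x))
    {p : CStarSeminorm D} (hp : p ∈ S) (x : D) : p x ≤ sup S hS x :=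
  le_ciSup (hS x) ⟨p, hp⟩

theorem sup_le {S : Set (CStarSeminorm D)}
    (hS : ∀ x : D, BddAbove (Set.range fun p : S => (p : CStarSeminorm D) x))
    {x : D} {r : ℝ} (hr : 0 ≤ r) (h : ∀ p ∈ S, p x ≤ r) : sup S hS x ≤ r :=
  Real.iSup_le (fun p => h p.1 p.2) hr

/-- The `C*`-seminorm `x ↦ ‖φ x‖` defined by a `*`-homomorphism into a `C*`-algebra. -/
def ofStarAlgHom {B : Type v} [CStarAlgebra B] (φ : D →⋆ₐ[ℂ] B) : CStarSeminorm D where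
  toFun x := ‖φ x‖
  map_zero' := by simp
  add_le' x y := by simpa using norm_add_le (φ x) (φ y)
  neg' x := by simp
  smul' a x := by simp [norm_smul]
  mul_le' x y := by simpa using norm_mul_le (φ x) (φ y)
  star_mul_self' x := by
    rw [map_mul, StarHomClass.map_star φ x]
    exact CStarRing.norm_star_mul_self (x := φ x)

@[simp] theorem ofStarAlgHom_apply {B : Type v} [CStarAlgebra B] (φ : D →⋆ₐ[ℂ] B) (x : D) :
    ofStarAlgHom φ x = ‖φ x‖ := rfl

/-- A copy of the `*`-algebra `D`, carrying the topology of the seminorm `p`. -/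
@[nolint unusedArguments]
def Pre (_p : CStarSeminorm D) : Type u := D

instance : Ring p.Pre := inferInstanceAs (Ring D)
instance : StarRing p.Pre := inferInstanceAs (StarRing D)
instance : Algebra ℂ p.Pre := inferInstanceAs (Algebra ℂ D)
instance [StarModule ℂ D] : StarModule ℂ p.Pre := inferInstanceAs (StarModule ℂ D)

instance : SeminormedRing p.Pre where
  __ := (inferInstance : Ring p.Pre)
  __ := p.toSeminorm.toAddGroupSeminorm.toSeminormedAddCommGroup
  norm_mul_le := p.mul_le

theorem norm_pre (x : p.Pre) : ‖x‖ = p x := rfl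

instance : NormedAlgebra ℂ p.Pre where
  norm_smul_le a x := (map_smul_eq_mul p.toSeminorm a x).le

instance : NormedStarGroup p.Pre where
  norm_star_le x := (p.map_star x).le

/-- The Hausdorff completion, as a normed algebra. -/
abbrev PreCompl (p : CStarSeminorm D) : Type u := UniformSpace.Completion p.Pre

open UniformSpace

theorem continuous_star_pre : UniformContinuous (star : p.Pre → p.Pre) :=
  star_isometry.uniformContinuous

instance : Star p.PreCompl := ⟨Completion.map star⟩

theorem coe_star (x : p.Pre) : ((star x : p.Pre) : p.PreCompl) = star (x : p.PreCompl) :=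
  (Completion.map_coe p.continuous_star_pre x).symm

instance : ContinuousStar p.PreCompl := ⟨Completion.continuous_map⟩

instance : StarRing p.PreCompl where
  star_involutive x := by
    induction x using Completion.induction_on with
    | hp => exact isClosed_eq (by fun_prop) (by fun_prop)
    | ih x => rw [← coe_star, ← coe_star, star_star]
  star_mul x y := by
    induction x, y using Completion.induction_on₂ with
    | hp => exact isClosed_eq (by fun_prop) (by fun_prop)
    | ih x y => rw [← Completion.coe_mul, ← coe_star, ← coe_star, ← coe_star, star_mul,
        Completion.coe_mul]
  star_add x y := by
    induction x, y using Completion.induction_on₂ with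
    | hp => exact isClosed_eq (by fun_prop) (by fun_prop)
    | ih x y => rw [← Completion.coe_add, ← coe_star, ← coe_star, ← coe_star, star_add,
        Completion.coe_add]

instance : CStarRing p.PreCompl where
  norm_mul_self_le x := by
    induction x using Completion.induction_on with
    | hp => exact isClosed_le (by fun_prop) (by fun_prop)
    | ih x =>
      rw [← coe_star, ← Completion.coe_mul, Completion.norm_coe, Completion.norm_coe]
      exact (p.star_mul_self x).ge

instance : NormedAlgebra ℂ p.PreCompl where
  norm_smul_le := norm_smul_le

instance [StarModule ℂ D] : StarModule ℂ p.PreCompl where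
  star_smul a x := by
    induction x using Completion.induction_on with
    | hp =>
      exact isClosed_eq (continuous_star.comp (continuous_const_smul a))
        ((continuous_const_smul (star a)).comp continuous_star)
    | ih x => rw [← Completion.coe_smul, ← coe_star, ← coe_star, star_smul, Completion.coe_smul]

instance [StarModule ℂ D] : CStarAlgebra p.PreCompl where

/-- The Hausdorff completion of the `*`-algebra `D` for the `C*`-seminorm `p`. -/
def Compl (p : CStarSeminorm D) : Type u := p.PreCompl

instance [StarModule ℂ D] : CStarAlgebra p.Compl := inferInstanceAs (CStarAlgebra p.PreCompl)

/-- The identity map from `D` to its copy `p.Pre`. -/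
def toPre : D →⋆ₐ[ℂ] p.Pre := StarAlgHom.id ℂ D

/-- A `*`-homomorphism on `D`, seen as a `*`-homomorphism on the copy `p.Pre`. -/
def ofPre {B : Type v} [CStarAlgebra B] (φ : D →⋆ₐ[ℂ] B) : p.Pre →⋆ₐ[ℂ] B := φ

variable [StarModule ℂ D]

/-- The canonical map into the completion. -/
def toPreCompl : D →⋆ₐ[ℂ] p.PreCompl where
  toFun x := (p.toPre x : p.PreCompl)
  map_one' := Completion.coe_one _
  map_mul' x y := Completion.coe_mul (p.toPre x) (p.toPre y)
  map_zero' := Completion.coe_zero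
  map_add' x y := Completion.coe_add (p.toPre x) (p.toPre y)
  commutes' _ := rfl
  map_star' x := p.coe_star (p.toPre x)

/-- The canonical `*`-homomorphism with dense range into the completion. -/
def toCompl : D →⋆ₐ[ℂ] p.Compl := p.toPreCompl

theorem norm_toCompl (x : D) : ‖p.toCompl x‖ = p x := Completion.norm_coe (p.toPre x)

theorem denseRange_toCompl : DenseRange p.toCompl :=
  Completion.denseRange_coe (α := p.Pre)

/-- A `*`-homomorphism that is bounded by `p` extends to the completion (auxiliary form). -/
def preExtend {B : Type v} [CStarAlgebra B] (φ : D →⋆ₐ[ℂ] B) (h : ∀ x, ‖φ x‖ ≤ p x) :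
    p.PreCompl →⋆ₐ[ℂ] B :=
  let ψ : p.Pre →L[ℂ] B :=
    LinearMap.mkContinuous (p.ofPre φ).toAlgHom.toLinearMap 1 (fun x => by simpa using! h x)
  have hψ (x : p.Pre) : ψ.fromCompletion (x : p.PreCompl) = p.ofPre φ x :=
    ψ.fromCompletion_apply_coe x
  { toFun := ψ.fromCompletion
    map_one' := (hψ 1).trans (map_one _)
    map_mul' := fun x y => by
      induction x, y using Completion.induction_on₂ with
      | hp => exact isClosed_eq (by fun_prop) (by fun_prop)
      | ih x y => rw [← Completion.coe_mul, hψ, hψ, hψ, map_mul]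
    map_zero' := map_zero _
    map_add' := map_add _
    commutes' := fun r => (hψ (algebraMap ℂ p.Pre r)).trans (AlgHomClass.commutes _ r)
    map_star' := fun x => by
      induction x using Completion.induction_on with
      | hp => exact isClosed_eq (by fun_prop) (by fun_prop)
      | ih x => rw [← coe_star, hψ, hψ, StarHomClass.map_star] }

/-- A `*`-homomorphism that is bounded by `p` extends to the completion. -/
def extend {B : Type v} [CStarAlgebra B] (φ : D →⋆ₐ[ℂ] B) (h : ∀ x, ‖φ x‖ ≤ p x) :
    p.Compl →⋆ₐ[ℂ] B := p.preExtend φ h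

theorem extend_toCompl {B : Type v} [CStarAlgebra B] (φ : D →⋆ₐ[ℂ] B) (h : ∀ x, ‖φ x‖ ≤ p x)
    (x : D) : p.extend φ h (p.toCompl x) = φ x :=
  ContinuousLinearMap.fromCompletion_apply_coe _ (p.toPre x)

/-- Two `*`-homomorphisms on the completion agree if they agree on `D`. -/
theorem hom_ext {B : Type v} [CStarAlgebra B] {φ ψ : p.Compl →⋆ₐ[ℂ] B}
    (h : ∀ x : D, φ (p.toCompl x) = ψ (p.toCompl x)) : φ = ψ := by
  have hc (χ : p.Compl →⋆ₐ[ℂ] B) : Continuous χ :=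
    AddMonoidHomClass.continuous_of_bound χ 1
      (fun x => by simpa using NonUnitalStarAlgHom.norm_apply_le χ x)
  exact DFunLike.coe_injective (p.denseRange_toCompl.equalizer (hc φ) (hc ψ) (funext h))

end basic

end CStarSeminorm

/-! ### Free `*`-algebras -/

/-- Words in the letters `x` (encoded as `(x, false)`) and `x*` (encoded as `(x, true)`). -/
abbrev StarWord (X : Type u) : Type u := FreeMonoid (X × Bool)

namespace StarWord

variable {X : Type u}

/-- The adjoint of a word: reverse the word and exchange every `x` with `x*`. -/
def adj (w : StarWord X) : StarWord X :=
  FreeMonoid.ofList ((w.toList.map fun l => (l.1, !l.2)).reverse)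

theorem adj_adj (w : StarWord X) : w.adj.adj = w := by
  simp [adj, List.map_reverse, Function.comp_def]

theorem adj_mul (v w : StarWord X) : (v * w).adj = w.adj * v.adj := by
  simp [adj]

end StarWord

/-- The free unital complex `*`-algebra on the set `X`: its elements are the noncommutative
polynomials in the letters `x` and `x*`, for `x` in `X`. -/
def FreeStarAlgebra (X : Type u) : Type u := MonoidAlgebra ℂ (StarWord X)

namespace FreeStarAlgebra

variable {X : Type u}

instance : Ring (FreeStarAlgebra X) := inferInstanceAs (Ring (MonoidAlgebra ℂ (StarWord X)))
instance : Algebra ℂ (FreeStarAlgebra X) :=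
  inferInstanceAs (Algebra ℂ (MonoidAlgebra ℂ (StarWord X)))

/-- The monomial `a w`. -/
def monomial (w : StarWord X) (a : ℂ) : FreeStarAlgebra X := MonoidAlgebra.single w a

theorem monomial_add (w : StarWord X) (a b : ℂ) :
    monomial w (a + b) = monomial w a + monomial w b := MonoidAlgebra.single_add ..

theorem monomial_mul (v w : StarWord X) (a b : ℂ) :
    monomial v a * monomial w b = monomial (v * w) (a * b) := MonoidAlgebra.single_mul_single ..

theorem smul_monomial (c : ℂ) (w : StarWord X) (a : ℂ) :
    c • monomial w a = monomial w (c * a) := MonoidAlgebra.smul_single ..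

@[elab_as_elim]
theorem induction {P : FreeStarAlgebra X → Prop} (x : FreeStarAlgebra X) (zero : P 0)
    (add : ∀ x y, P x → P y → P (x + y)) (monomial : ∀ w a, P (monomial w a)) : P x :=
  MonoidAlgebra.induction_linear x zero (fun x y => add x y) monomial

/-- The involution `∑ a_w w ↦ ∑ conj(a_w) w*`. -/
instance : Star (FreeStarAlgebra X) where
  star x := (MonoidAlgebra.coeff x).sum fun w a => monomial w.adj (star a)

theorem star_monomial (w : StarWord X) (a : ℂ) :
    star (monomial w a) = monomial w.adj (star a) :=
  Finsupp.sum_single_index (by rw [star_zero]; exact MonoidAlgebra.single_zero _)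

theorem star_add' (x y : FreeStarAlgebra X) : star (x + y) = star x + star y :=
  Finsupp.sum_add_index' (fun _ => by rw [star_zero]; exact MonoidAlgebra.single_zero _)
    (fun _ _ _ => by rw [star_add, monomial_add])

theorem star_zero' : star (0 : FreeStarAlgebra X) = 0 := Finsupp.sum_zero_index

instance : StarRing (FreeStarAlgebra X) where
  star_involutive x := by
    induction x using induction with
    | zero => rw [star_zero', star_zero']
    | add x y hx hy => rw [star_add', star_add', hx, hy]
    | monomial w a => rw [star_monomial, star_monomial, star_star, StarWord.adj_adj]
  star_add := star_add'
  star_mul x y := by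
    induction x using induction with
    | zero => rw [zero_mul, star_zero', mul_zero]
    | add x x' hx hx' => rw [add_mul, star_add', star_add', mul_add, hx, hx']
    | monomial v a =>
      induction y using induction with
      | zero => rw [mul_zero, star_zero', zero_mul]
      | add y y' hy hy' => rw [mul_add, star_add', star_add', add_mul, hy, hy']
      | monomial w b =>
        simp only [monomial_mul, star_monomial, StarWord.adj_mul, star_mul]

instance : StarModule ℂ (FreeStarAlgebra X) where
  star_smul c x := by
    induction x using induction with
    | zero => rw [smul_zero, star_zero, smul_zero]
    | add x y hx hy => rw [smul_add, star_add, star_add, smul_add, hx, hy]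
    | monomial w a => rw [smul_monomial, star_monomial, star_monomial, smul_monomial, star_mul,
        mul_comm]

/-- The free generator attached to `x`. -/
def ι (x : X) : FreeStarAlgebra X := monomial (FreeMonoid.of (x, false)) 1

/-- A family of elements of a `*`-algebra defines a `*`-homomorphism on the free `*`-algebra. -/
def lift {B : Type v} [Ring B] [StarRing B] [Algebra ℂ B] [StarModule ℂ B] (f : X → B) :
    FreeStarAlgebra X →⋆ₐ[ℂ] B :=
  let g : StarWord X →* B := FreeMonoid.lift fun l => if l.2 then star (f l.1) else f l.1
  have hg (w : StarWord X) : g w.adj = star (g w) := by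
    induction w using FreeMonoid.inductionOn with
    | one => rw [map_one, star_one]; exact map_one g
    | of l =>
      change g (FreeMonoid.of (l.1, !l.2)) = _
      rcases l with ⟨x, b⟩
      cases b <;> simp [g]
    | mul v w hv hw => rw [StarWord.adj_mul, map_mul, map_mul, star_mul, hv, hw]
  let φ : FreeStarAlgebra X →ₐ[ℂ] B := MonoidAlgebra.lift ℂ B (StarWord X) g
  have hφ (w : StarWord X) (a : ℂ) : φ (monomial w a) = a • g w := MonoidAlgebra.lift_single ..
  { φ with
    map_star' := fun x => by
      change φ (star x) = star (φ x)
      induction x using induction with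
      | zero => rw [star_zero, map_zero, star_zero]
      | add x y hx hy => rw [star_add, map_add, map_add, star_add, hx, hy]
      | monomial w a => rw [star_monomial, hφ, hφ, hg, star_smul] }

@[simp]
theorem lift_ι {B : Type v} [Ring B] [StarRing B] [Algebra ℂ B] [StarModule ℂ B] (f : X → B)
    (x : X) : lift f (ι x) = f x := by
  refine (MonoidAlgebra.lift_single ..).trans ?_
  simp

theorem monomial_of_mul (l : X × Bool) (w : StarWord X) :
    monomial (FreeMonoid.of l * w) 1 =
      (if l.2 then star (ι l.1) else ι l.1) * monomial w 1 := by
  rcases l with ⟨x, b⟩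
  cases b
  · simp [ι, monomial_mul]
  · simp only [if_true, ι, star_monomial, monomial_mul, star_one, mul_one]
    rfl

theorem monomial_one_one : (monomial 1 1 : FreeStarAlgebra X) = 1 := rfl

/-- A subset closed under the `*`-algebra operations that contains the generators is everything. -/
theorem adjoin_ι : StarAlgebra.adjoin ℂ (Set.range (ι : X → FreeStarAlgebra X)) = ⊤ := by
  refine top_unique fun x _ => ?_
  induction x using induction with
  | zero => exact zero_mem _
  | add x y hx hy => exact add_mem (hx trivial) (hy trivial)
  | monomial w a =>
    rw [← mul_one a, ← smul_monomial]
    refine SMulMemClass.smul_mem a ?_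
    induction w using FreeMonoid.inductionOn' with
    | one => rw [monomial_one_one]; exact one_mem _
    | of_mul l w hw0 =>
      rw [monomial_of_mul]
      refine mul_mem ?_ (hw0 trivial)
      split_ifs
      · exact star_mem (StarAlgebra.subset_adjoin ℂ _ ⟨_, rfl⟩)
      · exact StarAlgebra.subset_adjoin ℂ _ ⟨_, rfl⟩

/-- A `C*`-seminorm is controlled by its values on the generators. -/
theorem seminorm_bound (S : Set (CStarSeminorm (FreeStarAlgebra X)))
    (h1 : ∀ x : X, BddAbove (Set.range fun p : S => (p : CStarSeminorm _) (ι x)))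
    (y : FreeStarAlgebra X) : BddAbove (Set.range fun p : S => (p : CStarSeminorm _) y) := by
  have key : ∃ r : ℝ, ∀ p ∈ S, p y ≤ r := by
    have hy : y ∈ StarAlgebra.adjoin ℂ (Set.range (ι : X → FreeStarAlgebra X)) := by
      rw [adjoin_ι]; trivial
    induction hy using StarAlgebra.adjoin_induction with
    | mem y hy =>
      obtain ⟨x, rfl⟩ := hy
      obtain ⟨r, hr⟩ := h1 x
      exact ⟨r, fun p hp => hr ⟨⟨p, hp⟩, rfl⟩⟩
    | algebraMap c =>
      refine ⟨‖c‖, fun p _ => ?_⟩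
      have h2 : p 1 ≤ 1 := by
        have := p.star_mul_self 1
        simp only [star_one, mul_one] at this
        nlinarith [p.nonneg 1]
      rw [Algebra.algebraMap_eq_smul_one, map_smul_eq_mul]
      nlinarith [norm_nonneg c]
    | add x y _ _ hx hy =>
      obtain ⟨r, hr⟩ := hx
      obtain ⟨s, hs⟩ := hy
      exact ⟨r + s, fun p hp => (map_add_le_add p.toSeminorm x y).trans
        (add_le_add (hr p hp) (hs p hp))⟩
    | mul x y _ _ hx hy =>
      obtain ⟨r, hr⟩ := hx
      obtain ⟨s, hs⟩ := hy
      refine ⟨r * s, fun p hp => (p.mul_le x y).trans ?_⟩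
      exact mul_le_mul (hr p hp) (hs p hp) (p.nonneg y) ((p.nonneg x).trans (hr p hp))
    | star x _ hx =>
      obtain ⟨r, hr⟩ := hx
      exact ⟨r, fun p hp => (p.map_star x).trans_le (hr p hp)⟩
  obtain ⟨r, hr⟩ := key
  exact ⟨r, by rintro _ ⟨p, rfl⟩; exact hr p.1 p.2⟩

end FreeStarAlgebra

/-! ### Hilbert space tensor products and the minimal tensor product of `C*`-algebras -/

section HilbertTensor

variable (H : Type u) (K : Type v) [NormedAddCommGroup H] [InnerProductSpace ℂ H]
  [NormedAddCommGroup K] [InnerProductSpace ℂ K]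

/-- The Hilbert space tensor product of `H` and `K`. -/
def HilbertTensor : Type (max u v) := UniformSpace.Completion (H ⊗[ℂ] K)

instance : NormedAddCommGroup (HilbertTensor H K) :=
  inferInstanceAs (NormedAddCommGroup (UniformSpace.Completion (H ⊗[ℂ] K)))
instance : InnerProductSpace ℂ (HilbertTensor H K) :=
  inferInstanceAs (InnerProductSpace ℂ (UniformSpace.Completion (H ⊗[ℂ] K)))
instance : CompleteSpace (HilbertTensor H K) :=
  inferInstanceAs (CompleteSpace (UniformSpace.Completion (H ⊗[ℂ] K)))

variable {H K}

/-- The inclusion of the algebraic tensor product. -/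
def HilbertTensor.of : H ⊗[ℂ] K →ₗᵢ[ℂ] HilbertTensor H K :=
  (UniformSpace.Completion.toComplₗᵢ : H ⊗[ℂ] K →ₗᵢ[ℂ] UniformSpace.Completion (H ⊗[ℂ] K))

open HilbertTensor (of)

theorem HilbertTensor.denseRange_of : DenseRange (of : H ⊗[ℂ] K → HilbertTensor H K) :=
  UniformSpace.Completion.denseRange_coe

/-- The bounded operator `S ⊗ T` on the Hilbert space tensor product. -/
def tensorOp (S : H →L[ℂ] H) (T : K →L[ℂ] K) : HilbertTensor H K →L[ℂ] HilbertTensor H K :=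
  ((TensorProduct.mapL S T).completion :
    UniformSpace.Completion (H ⊗[ℂ] K) →L[ℂ] UniformSpace.Completion (H ⊗[ℂ] K))

theorem tensorOp_of (S : H →L[ℂ] H) (T : K →L[ℂ] K) (x : H ⊗[ℂ] K) :
    tensorOp S T (of x) = of (TensorProduct.mapL S T x) :=
  ContinuousLinearMap.completion_apply_coe _ _

@[simp]
theorem tensorOp_of_tmul (S : H →L[ℂ] H) (T : K →L[ℂ] K) (x : H) (y : K) :
    tensorOp S T (of (x ⊗ₜ y)) = of (S x ⊗ₜ T y) :=
  tensorOp_of S T (x ⊗ₜ y)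

theorem hilbertTensor_ext {S T : HilbertTensor H K →L[ℂ] HilbertTensor H K}
    (h : ∀ (x : H) (y : K), S (of (x ⊗ₜ[ℂ] y)) = T (of (x ⊗ₜ[ℂ] y))) : S = T := by
  refine DFunLike.coe_injective (HilbertTensor.denseRange_of.equalizer S.continuous T.continuous
    (funext fun z => ?_))
  simp only [Function.comp_apply]
  induction z using TensorProduct.induction_on with
  | zero => simp
  | tmul x y => exact h x y
  | add x y hx hy => rw [map_add, map_add, map_add, hx, hy]

theorem tensorOp_mul (S S' : H →L[ℂ] H) (T T' : K →L[ℂ] K) :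
    tensorOp (S * S') (T * T') = tensorOp S T * tensorOp S' T' :=
  hilbertTensor_ext fun x y => by simp

theorem tensorOp_one : tensorOp (1 : H →L[ℂ] H) (1 : K →L[ℂ] K) = 1 :=
  hilbertTensor_ext fun x y => by simp

theorem tensorOp_add_left (S S' : H →L[ℂ] H) (T : K →L[ℂ] K) :
    tensorOp (S + S') T = tensorOp S T + tensorOp S' T :=
  hilbertTensor_ext fun x y => by simp [TensorProduct.add_tmul]

theorem tensorOp_add_right (S : H →L[ℂ] H) (T T' : K →L[ℂ] K) :
    tensorOp S (T + T') = tensorOp S T + tensorOp S T' :=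
  hilbertTensor_ext fun x y => by simp [TensorProduct.tmul_add]

theorem tensorOp_smul_left (a : ℂ) (S : H →L[ℂ] H) (T : K →L[ℂ] K) :
    tensorOp (a • S) T = a • tensorOp S T :=
  hilbertTensor_ext fun x y => by simp [← TensorProduct.smul_tmul']

theorem tensorOp_smul_right (a : ℂ) (S : H →L[ℂ] H) (T : K →L[ℂ] K) :
    tensorOp S (a • T) = a • tensorOp S T :=
  hilbertTensor_ext fun x y => by simp [TensorProduct.tmul_smul]

theorem tensorOp_zero_left (T : K →L[ℂ] K) : tensorOp (0 : H →L[ℂ] H) T = 0 :=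
  hilbertTensor_ext fun x y => by simp

theorem tensorOp_zero_right (S : H →L[ℂ] H) : tensorOp S (0 : K →L[ℂ] K) = 0 :=
  hilbertTensor_ext fun x y => by simp

theorem star_tensorOp [CompleteSpace H] [CompleteSpace K] (S : H →L[ℂ] H) (T : K →L[ℂ] K) :
    star (tensorOp S T) = tensorOp (star S) (star T) := by
  symm
  refine (ContinuousLinearMap.eq_adjoint_iff _ _).mpr fun x y => ?_
  refine HilbertTensor.denseRange_of.induction_on₂
    (p := fun x y => inner ℂ (tensorOp (star S) (star T) x) y = inner ℂ x (tensorOp S T y))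
    (isClosed_eq (by fun_prop) (by fun_prop)) (fun x y => ?_) x y
  · rw [tensorOp_of, tensorOp_of, LinearIsometry.inner_map_map, LinearIsometry.inner_map_map]
    induction x using TensorProduct.induction_on with
    | zero => simp
    | add x x' hx hx' => rw [map_add, inner_add_left, inner_add_left, hx, hx']
    | tmul a b =>
      induction y using TensorProduct.induction_on with
      | zero => simp
      | add y y' hy hy' => rw [map_add, inner_add_right, inner_add_right, hy, hy']
      | tmul c d =>
        simp [ContinuousLinearMap.star_eq_adjoint, ContinuousLinearMap.adjoint_inner_left]

variable (H K) in
/-- The `*`-homomorphism `S ↦ S ⊗ 1`. -/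
def leftAmp [CompleteSpace H] [CompleteSpace K] :
    (H →L[ℂ] H) →⋆ₐ[ℂ] (HilbertTensor H K →L[ℂ] HilbertTensor H K) where
  toFun S := tensorOp S 1
  map_one' := tensorOp_one
  map_mul' S S' := by rw [← tensorOp_mul, mul_one]
  map_zero' := tensorOp_zero_left 1
  map_add' S S' := tensorOp_add_left S S' 1
  commutes' a := by
    rw [Algebra.algebraMap_eq_smul_one, tensorOp_smul_left, tensorOp_one,
      Algebra.algebraMap_eq_smul_one]
  map_star' S := by rw [star_tensorOp, star_one]

variable (H K) in
/-- The `*`-homomorphism `T ↦ 1 ⊗ T`. -/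
def rightAmp [CompleteSpace H] [CompleteSpace K] :
    (K →L[ℂ] K) →⋆ₐ[ℂ] (HilbertTensor H K →L[ℂ] HilbertTensor H K) where
  toFun T := tensorOp 1 T
  map_one' := tensorOp_one
  map_mul' S S' := by rw [← tensorOp_mul, mul_one]
  map_zero' := tensorOp_zero_right 1
  map_add' S S' := tensorOp_add_right 1 S S'
  commutes' a := by
    rw [Algebra.algebraMap_eq_smul_one, tensorOp_smul_right, tensorOp_one,
      Algebra.algebraMap_eq_smul_one]
  map_star' S := by rw [star_tensorOp, star_one]

end HilbertTensor

/-- A representation of a unital `C*`-algebra on a Hilbert space. -/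
structure HilbertRep (A : Type u) [CStarAlgebra A] : Type (u + 1) where
  space : Type u
  [normed : NormedAddCommGroup space]
  [inner : InnerProductSpace ℂ space]
  [complete : CompleteSpace space]
  hom : A →⋆ₐ[ℂ] (space →L[ℂ] space)

attribute [instance] HilbertRep.normed HilbertRep.inner HilbertRep.complete

/-- The algebraic tensor product of two `*`-algebras is a `*`-algebra. -/
instance tensorStarRing {A : Type u} {B : Type v} [Ring A] [StarRing A] [Algebra ℂ A]
    [StarModule ℂ A] [Ring B] [StarRing B] [Algebra ℂ B] [StarModule ℂ B] :
    StarRing (A ⊗[ℂ] B) where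
  star_add := star_add
  star_mul x y := by
    induction x using TensorProduct.induction_on with
    | zero => simp
    | add x x' hx hx' => rw [add_mul, star_add, star_add, mul_add, hx, hx']
    | tmul a b =>
      induction y using TensorProduct.induction_on with
      | zero => simp
      | add y y' hy hy' => rw [mul_add, star_add, star_add, add_mul, hy, hy']
      | tmul c d => simp

section MinTensor

variable {A A' : Type u} {B B' : Type v} [CStarAlgebra A] [CStarAlgebra B]
  [CStarAlgebra A'] [CStarAlgebra B']

/-- The algebra homomorphism underlying `tensorRep`. -/
def tensorRepAux (π : HilbertRep A) (ρ : HilbertRep B) :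
    A ⊗[ℂ] B →ₐ[ℂ]
      (HilbertTensor π.space ρ.space →L[ℂ] HilbertTensor π.space ρ.space) :=
  Algebra.TensorProduct.lift
    ((leftAmp π.space ρ.space).comp π.hom).toAlgHom
    ((rightAmp π.space ρ.space).comp ρ.hom).toAlgHom
    (fun a b => by
      change tensorOp (π.hom a) 1 * tensorOp 1 (ρ.hom b) =
        tensorOp 1 (ρ.hom b) * tensorOp (π.hom a) 1
      rw [← tensorOp_mul, ← tensorOp_mul]; simp only [mul_one, one_mul])

theorem tensorRepAux_tmul (π : HilbertRep A) (ρ : HilbertRep B) (a : A) (b : B) :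
    tensorRepAux π ρ (a ⊗ₜ b) = tensorOp (π.hom a) (ρ.hom b) := by
  refine (Algebra.TensorProduct.lift_tmul _ _ _ a b).trans ?_
  change tensorOp (π.hom a) 1 * tensorOp 1 (ρ.hom b) = _
  rw [← tensorOp_mul]; simp only [mul_one, one_mul]

/-- The representation `a ⊗ b ↦ π(a) ⊗ ρ(b)` of the algebraic tensor product. -/
def tensorRep (π : HilbertRep A) (ρ : HilbertRep B) :
    A ⊗[ℂ] B →⋆ₐ[ℂ]
      (HilbertTensor π.space ρ.space →L[ℂ] HilbertTensor π.space ρ.space) where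
  __ := tensorRepAux π ρ
  map_star' x := by
    change tensorRepAux π ρ (star x) = star (tensorRepAux π ρ x)
    induction x using TensorProduct.induction_on with
    | zero => simp
    | add x y hx hy => rw [star_add, map_add, map_add, star_add, hx, hy]
    | tmul a b =>
      rw [TensorProduct.star_tmul, tensorRepAux_tmul, tensorRepAux_tmul, star_tensorOp,
        StarHomClass.map_star, StarHomClass.map_star]

theorem tensorRep_tmul (π : HilbertRep A) (ρ : HilbertRep B) (a : A) (b : B) :
    tensorRep π ρ (a ⊗ₜ b) = tensorOp (π.hom a) (ρ.hom b) := tensorRepAux_tmul π ρ a b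

theorem norm_tensorRep_tmul_le (π : HilbertRep A) (ρ : HilbertRep B) (a : A) (b : B) :
    ‖tensorRep π ρ (a ⊗ₜ b)‖ ≤ ‖a‖ * ‖b‖ := by
  have h : tensorRep π ρ (a ⊗ₜ b) = (leftAmp π.space ρ.space).comp π.hom a *
      (rightAmp π.space ρ.space).comp ρ.hom b := by
    rw [tensorRep_tmul]
    change _ = tensorOp (π.hom a) 1 * tensorOp 1 (ρ.hom b)
    rw [← tensorOp_mul]; simp only [mul_one, one_mul]
  rw [h]
  exact (norm_mul_le _ _).trans (mul_le_mul (NonUnitalStarAlgHom.norm_apply_le _ a)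
    (NonUnitalStarAlgHom.norm_apply_le _ b) (norm_nonneg _) (norm_nonneg _))

variable (A B) in
/-- The seminorms `x ↦ ‖(π ⊗ ρ)(x)‖` on the algebraic tensor product. -/
def spatialSeminorms : Set (CStarSeminorm (A ⊗[ℂ] B)) :=
  {p | ∃ (π : HilbertRep A) (ρ : HilbertRep B), p = CStarSeminorm.ofStarAlgHom (tensorRep π ρ)}

theorem spatial_bdd (x : A ⊗[ℂ] B) :
    BddAbove (Set.range fun p : spatialSeminorms A B => (p : CStarSeminorm _) x) := by
  have key : ∃ r : ℝ, ∀ (π : HilbertRep A) (ρ : HilbertRep B), ‖tensorRep π ρ x‖ ≤ r := by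
    induction x using TensorProduct.induction_on with
    | zero => exact ⟨0, fun π ρ => by rw [map_zero, norm_zero]⟩
    | tmul a b => exact ⟨‖a‖ * ‖b‖, fun π ρ => norm_tensorRep_tmul_le π ρ a b⟩
    | add x y hx hy =>
      obtain ⟨r, hr⟩ := hx
      obtain ⟨s, hs⟩ := hy
      refine ⟨r + s, fun π ρ => ?_⟩
      rw [map_add]
      exact (norm_add_le _ _).trans (add_le_add (hr π ρ) (hs π ρ))
  obtain ⟨r, hr⟩ := key
  refine ⟨r, ?_⟩
  rintro _ ⟨⟨_, π, ρ, rfl⟩, rfl⟩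
  exact hr π ρ

variable (A B) in
/-- The spatial (minimal) `C*`-norm on the algebraic tensor product:
`‖x‖ = sup ‖(π ⊗ ρ)(x)‖` over all representations `π` of `A` and `ρ` of `B`. -/
def spatialNorm : CStarSeminorm (A ⊗[ℂ] B) :=
  CStarSeminorm.sup (spatialSeminorms A B) spatial_bdd

variable (A B) in
/-- The minimal `C*`-algebraic tensor product. -/
abbrev MinTensor : Type (max u v) := (spatialNorm A B).Compl

/-- The elementary tensor `a ⊗ b` in the minimal tensor product. -/
def minTmul (a : A) (b : B) : MinTensor A B := (spatialNorm A B).toCompl (a ⊗ₜ[ℂ] b)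

/-- The `*`-homomorphism `φ ⊗ ψ` between algebraic tensor products. -/
def algTensorMap (φ : A →⋆ₐ[ℂ] A') (ψ : B →⋆ₐ[ℂ] B') : A ⊗[ℂ] B →⋆ₐ[ℂ] A' ⊗[ℂ] B' where
  __ := Algebra.TensorProduct.map φ.toAlgHom ψ.toAlgHom
  map_star' x := by
    change Algebra.TensorProduct.map φ.toAlgHom ψ.toAlgHom (star x) =
      star (Algebra.TensorProduct.map φ.toAlgHom ψ.toAlgHom x)
    induction x using TensorProduct.induction_on with
    | zero => simp
    | add x y hx hy => rw [star_add, map_add, map_add, star_add, hx, hy]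
    | tmul a b => simp [map_star]

theorem algTensorMap_tmul (φ : A →⋆ₐ[ℂ] A') (ψ : B →⋆ₐ[ℂ] B') (a : A) (b : B) :
    algTensorMap φ ψ (a ⊗ₜ b) = φ a ⊗ₜ ψ b := rfl

/-- Restriction of a representation along a `*`-homomorphism. -/
def HilbertRep.comap (π : HilbertRep A') (φ : A →⋆ₐ[ℂ] A') : HilbertRep A where
  space := π.space
  hom := π.hom.comp φ

theorem tensorRep_algTensorMap (φ : A →⋆ₐ[ℂ] A') (ψ : B →⋆ₐ[ℂ] B') (π : HilbertRep A')
    (ρ : HilbertRep B') (x : A ⊗[ℂ] B) :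
    tensorRep π ρ (algTensorMap φ ψ x) = tensorRep (π.comap φ) (ρ.comap ψ) x := by
  induction x using TensorProduct.induction_on with
  | zero => rw [map_zero, map_zero]; exact (map_zero _).symm
  | add x y hx hy => rw [map_add, map_add, hx, hy]; exact (map_add _ x y).symm
  | tmul a b => rw [algTensorMap_tmul, tensorRep_tmul]; exact (tensorRep_tmul ..).symm

/-- The `*`-homomorphism `φ ⊗ ψ` between minimal tensor products. -/
def minTensorMap (φ : A →⋆ₐ[ℂ] A') (ψ : B →⋆ₐ[ℂ] B') : MinTensor A B →⋆ₐ[ℂ] MinTensor A' B' :=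
  (spatialNorm A B).extend ((spatialNorm A' B').toCompl.comp (algTensorMap φ ψ)) (fun x => by
    rw [StarAlgHom.comp_apply, CStarSeminorm.norm_toCompl]
    refine CStarSeminorm.sup_le _ (CStarSeminorm.nonneg _ x) ?_
    rintro _ ⟨π, ρ, rfl⟩
    rw [CStarSeminorm.ofStarAlgHom_apply, tensorRep_algTensorMap]
    exact CStarSeminorm.le_sup (p := CStarSeminorm.ofStarAlgHom (tensorRep (π.comap φ) (ρ.comap ψ)))
      spatial_bdd ⟨_, _, rfl⟩ x)

theorem minTensorMap_tmul (φ : A →⋆ₐ[ℂ] A') (ψ : B →⋆ₐ[ℂ] B') (a : A) (b : B) :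
    minTensorMap φ ψ (minTmul a b) = minTmul (φ a) (ψ b) :=
  CStarSeminorm.extend_toCompl ..

end MinTensor

/-! ### Representations that do not vanish on a given projection -/

section States

variable {A : Type u} [CStarAlgebra A]

theorem im_eq_zero_of_contraction (h : A →L[ℂ] ℂ) (hn : ∀ a, ‖h a‖ ≤ ‖a‖) (h1 : h 1 = 1)
    (a : A) (ha : IsSelfAdjoint a) : (h a).im = 0 := by
  have key (s : ℝ) : ((h a).im + s) ^ 2 ≤ ‖a‖ ^ 2 * 1 + s ^ 2 * ‖(1 : A)‖ := by
    have e : star (a + (Complex.I * s) • (1 : A)) * (a + (Complex.I * s) • (1 : A)) =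
        a * a + ((s : ℂ) ^ 2) • (1 : A) := by
      simp only [star_add, ha.star_eq, star_smul, star_one, add_mul, mul_add, 
        mul_smul_comm, smul_mul_assoc, one_mul, mul_one, RCLike.star_def, map_mul, Complex.conj_I,
        Complex.conj_ofReal]
      have : -Complex.I * s * (Complex.I * s) = (s : ℂ) ^ 2 := by
        linear_combination (-(s : ℂ) ^ 2) * Complex.I_mul_I
      rw [smul_add, smul_smul, mul_comm (Complex.I * (s : ℂ)) (-Complex.I * s), this]
      simp only [neg_mul, neg_smul]
      abel
    have n1 : ‖a + (Complex.I * s) • (1 : A)‖ ^ 2 ≤ ‖a‖ ^ 2 + s ^ 2 * ‖(1 : A)‖ := by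
      rw [sq, ← CStarRing.norm_star_mul_self, e]
      refine (norm_add_le _ _).trans ?_
      rw [norm_smul, norm_pow, Complex.norm_real, Real.norm_eq_abs, sq_abs]
      gcongr
      exact (norm_mul_le a a).trans_eq (sq _).symm
    have n2 : ((h a).im + s) ^ 2 ≤ ‖h (a + (Complex.I * s) • (1 : A))‖ ^ 2 := by
      have : (h (a + (Complex.I * s) • (1 : A))).im = (h a).im + s := by
        simp [h1]
      rw [← this]
      have := Complex.abs_im_le_norm (h (a + (Complex.I * s) • (1 : A)))
      rw [← sq_abs]
      gcongr
    refine n2.trans ((pow_le_pow_left₀ (norm_nonneg _) (hn _) 2).trans ?_)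
    linarith
  have hone : ‖(1 : A)‖ = 1 := by
    rcases subsingleton_or_nontrivial A with hA | hA
    · have : h 1 = 0 := by rw [Subsingleton.elim (1 : A) 0, map_zero]
      rw [this] at h1; norm_num at h1
    · exact norm_one
  rw [hone] at key
  by_contra hne
  have k := key (‖a‖ ^ 2 / (h a).im)
  have e2 : (h a).im * (‖a‖ ^ 2 / (h a).im) = ‖a‖ ^ 2 := by field_simp
  have : 0 < (h a).im ^ 2 := by positivity
  nlinarith [sq_nonneg ‖a‖]

theorem nonneg_of_contraction [PartialOrder A] [StarOrderedRing A] (h : A →L[ℂ] ℂ)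
    (hn : ∀ a, ‖h a‖ ≤ ‖a‖) (h1 : h 1 = 1) (a : A) (ha : 0 ≤ a) : 0 ≤ h a := by
  have hs : IsSelfAdjoint a := IsSelfAdjoint.of_nonneg ha
  have him := im_eq_zero_of_contraction h hn h1 a hs
  rw [Complex.nonneg_iff]
  refine ⟨?_, him.symm⟩
  have k1 : ‖algebraMap ℝ A ‖a‖ - a‖ ≤ ‖a‖ := by
    have l1 : a ≤ algebraMap ℝ A ‖a‖ := hs.le_algebraMap_norm_self
    rw [CStarAlgebra.norm_le_iff_le_algebraMap _ (norm_nonneg a) (sub_nonneg.mpr l1)]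
    exact sub_le_self _ ha
  have k2 := (hn _).trans k1
  have k3 : h (algebraMap ℝ A ‖a‖ - a) = ‖a‖ - h a := by
    rw [map_sub, Algebra.algebraMap_eq_smul_one, ← Complex.coe_smul, map_smul, h1]
    simp
  rw [k3] at k2
  have k4 := (Complex.re_le_norm _).trans k2
  simp at k4
  exact k4

/-- A nonzero projection is nonzero in some representation. -/
theorem exists_positive_ne_zero [PartialOrder A] [StarOrderedRing A] (p : A) (hp : star p = p)
    (hpp : p * p = p) (h0 : p ≠ 0) : ∃ f : A →ₚ[ℂ] ℂ, f p ≠ 0 := by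
  have hnorm : ‖p‖ = 1 := by
    have := CStarRing.norm_star_mul_self (x := p)
    rw [hp, hpp] at this
    have h2 : ‖p‖ ≠ 0 := norm_ne_zero_iff.mpr h0
    field_simp at this
    exact this.symm
  obtain ⟨g, hg, hgp⟩ := exists_dual_vector ℂ p (norm_ne_zero_iff.mpr h0)
  let h : A →L[ℂ] ℂ := g ∘L ((ContinuousLinearMap.mul ℂ A p) ∘L
    ((ContinuousLinearMap.mul ℂ A).flip p))
  have hh (a : A) : h a = g (p * (a * p)) := rfl
  have hn (a : A) : ‖h a‖ ≤ ‖a‖ := by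
    rw [hh]
    refine (g.le_opNorm _).trans ?_
    rw [hg, one_mul]
    refine (norm_mul_le _ _).trans ?_
    rw [hnorm, one_mul]
    refine (norm_mul_le _ _).trans ?_
    rw [hnorm, mul_one]
  have h1 : h 1 = 1 := by rw [hh, one_mul, hpp, hgp, hnorm]; simp
  refine ⟨PositiveLinearMap.mk₀ (h : A →ₗ[ℂ] ℂ) (nonneg_of_contraction h hn h1), ?_⟩
  change h p ≠ 0
  rw [hh, hpp, hpp, hgp, hnorm]
  simp

theorem exists_rep_ne_zero (p : A) (hp : star p = p) (hpp : p * p = p) (h0 : p ≠ 0) :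
    ∃ (H : Type u) (_ : NormedAddCommGroup H) (_ : InnerProductSpace ℂ H) (_ : CompleteSpace H)
      (π : A →⋆ₐ[ℂ] (H →L[ℂ] H)), π p ≠ 0 := by
  let _ : PartialOrder A := CStarAlgebra.spectralOrder A
  have _ : StarOrderedRing A := CStarAlgebra.spectralOrderedRing A
  obtain ⟨f, hf⟩ := exists_positive_ne_zero p hp hpp h0
  refine ⟨f.GNS, inferInstance, inferInstance, inferInstance, f.gnsStarAlgHom, fun h => hf ?_⟩
  have e : f.gnsStarAlgHom p ((f.toPreGNS 1 : f.PreGNS) : f.GNS) = (f.toPreGNS p : f.PreGNS) := by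
    refine (f.gnsNonUnitalStarAlgHom_apply_coe).trans ?_
    rw [f.leftMulMapPreGNS_apply]
    simp
  rw [h] at e
  have e2 : ‖f.toPreGNS p‖ = 0 := by
    rw [← UniformSpace.Completion.norm_coe, ← e]
    exact norm_zero
  have e3 := f.preGNS_norm_sq (f.toPreGNS p)
  rw [e2, PositiveLinearMap.ofPreGNS_toPreGNS, hp, hpp] at e3
  rw [← e3]
  simp

end States

/-! ### Compact matrix quantum groups -/

/-- A compact matrix quantum group whose fundamental representation is indexed by `n`. -/
structure CompactMatrixQuantumGroup (n : Type v) [Fintype n] [DecidableEq n] :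
    Type (max (u + 1) v) where
  /-- The `C*`-algebra `C(𝔾)`. -/
  algebra : Type u
  [cstarAlgebra : CStarAlgebra algebra]
  /-- The fundamental representation. -/
  u : Matrix n n algebra
  /-- The entries of `u` generate `C(𝔾)` as a `C*`-algebra. -/
  generates : (StarAlgebra.adjoin ℂ (Set.range fun ij : n × n => u ij.1 ij.2)).topologicalClosure
    = ⊤
  isUnit_u : IsUnit u
  isUnit_u_star : IsUnit (u.map star)
  /-- The comultiplication. -/
  comul : algebra →⋆ₐ[ℂ] MinTensor algebra algebra
  comul_u : ∀ i j, comul (u i j) = ∑ k, minTmul (u i k) (u k j)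

attribute [instance] CompactMatrixQuantumGroup.cstarAlgebra

/-- Isomorphism of (the compact quantum groups underlying) two compact matrix quantum groups: a
`*`-isomorphism `φ : C(𝔾) → C(ℍ)` with `(φ ⊗ φ) ∘ Δ = Δ ∘ φ`. -/
def CompactMatrixQuantumGroup.Isomorphic {n : Type v} {m : Type w} [Fintype n] [DecidableEq n] [Fintype m]
    [DecidableEq m] (G : CompactMatrixQuantumGroup.{u} n) (H : CompactMatrixQuantumGroup.{u} m) :
    Prop :=
  ∃ φ : G.algebra ≃⋆ₐ[ℂ] H.algebra, ∀ a : G.algebra,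
    minTensorMap (φ : G.algebra →⋆ₐ[ℂ] H.algebra) (φ : G.algebra →⋆ₐ[ℂ] H.algebra) (G.comul a) =
      H.comul (φ a)

/-! ### Universal `C*`-algebras -/

section Universal

variable {X : Type u}

/-- The `C*`-seminorms on the free `*`-algebra that vanish on the relators in `R`. -/
def relSeminorms (R : Set (FreeStarAlgebra X)) : Set (CStarSeminorm (FreeStarAlgebra X)) :=
  {p | ∀ r ∈ R, p r = 0}

/-- The relators `R` bound the norms of the generators, so that the universal `C*`-algebra
exists. -/
def IsBoundedRel (R : Set (FreeStarAlgebra X)) : Prop :=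
  ∀ x : X, BddAbove (Set.range fun p : relSeminorms R =>
    (p : CStarSeminorm (FreeStarAlgebra X)) (FreeStarAlgebra.ι x))

/-- The largest `C*`-seminorm on the free `*`-algebra that vanishes on the relators. -/
def universalSeminorm (R : Set (FreeStarAlgebra X)) (hR : IsBoundedRel R) :
    CStarSeminorm (FreeStarAlgebra X) :=
  CStarSeminorm.sup (relSeminorms R) (FreeStarAlgebra.seminorm_bound _ hR)

/-- The universal unital `C*`-algebra with generators `X` and relations `r = 0` for `r ∈ R`. -/
def UniversalCStar (R : Set (FreeStarAlgebra X)) (hR : IsBoundedRel R) : Type u :=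
  (universalSeminorm R hR).Compl

namespace UniversalCStar

variable {R : Set (FreeStarAlgebra X)} {hR : IsBoundedRel R}

instance : CStarAlgebra (UniversalCStar R hR) :=
  inferInstanceAs (CStarAlgebra (universalSeminorm R hR).Compl)

variable (R hR) in
/-- The canonical map from the free `*`-algebra. -/
def mk : FreeStarAlgebra X →⋆ₐ[ℂ] UniversalCStar R hR := (universalSeminorm R hR).toCompl

variable (R hR) in
/-- The generators. -/
def gen (x : X) : UniversalCStar R hR := mk R hR (FreeStarAlgebra.ι x)

theorem mk_rel {r : FreeStarAlgebra X} (hr : r ∈ R) : mk R hR r = 0 := by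
  rw [← norm_eq_zero]
  refine ((universalSeminorm R hR).norm_toCompl r).trans (le_antisymm ?_ (CStarSeminorm.nonneg _ _))
  exact CStarSeminorm.sup_le _ le_rfl fun p hp => (hp r hr).le

/-- The universal property. -/
def lift {B : Type v} [CStarAlgebra B] (f : X → B)
    (hf : ∀ r ∈ R, FreeStarAlgebra.lift f r = 0) : UniversalCStar R hR →⋆ₐ[ℂ] B :=
  (universalSeminorm R hR).extend (FreeStarAlgebra.lift f) fun x =>
    CStarSeminorm.le_sup (p := CStarSeminorm.ofStarAlgHom (FreeStarAlgebra.lift f)) _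
      (fun r hr => by rw [CStarSeminorm.ofStarAlgHom_apply, hf r hr, norm_zero]) x

theorem lift_gen {B : Type v} [CStarAlgebra B] (f : X → B)
    (hf : ∀ r ∈ R, FreeStarAlgebra.lift f r = 0) (x : X) :
    lift (hR := hR) f hf (gen R hR x) = f x :=
  (CStarSeminorm.extend_toCompl _ _ _ _).trans (FreeStarAlgebra.lift_ι f x)

theorem generates :
    (StarAlgebra.adjoin ℂ (Set.range (gen R hR))).topologicalClosure = ⊤ := by
  refine top_unique fun y _ => ?_
  have h1 (x : FreeStarAlgebra X) : mk R hR x ∈ StarAlgebra.adjoin ℂ (Set.range (gen R hR)) := by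
    have hx : x ∈ StarAlgebra.adjoin ℂ (Set.range (FreeStarAlgebra.ι : X → FreeStarAlgebra X)) := by
      rw [FreeStarAlgebra.adjoin_ι]; trivial
    induction hx using StarAlgebra.adjoin_induction with
    | mem x hx =>
      obtain ⟨x, rfl⟩ := hx
      exact StarAlgebra.subset_adjoin ℂ _ ⟨x, rfl⟩
    | algebraMap c => rw [AlgHomClass.commutes]; exact algebraMap_mem _ c
    | add x y _ _ hx hy => rw [map_add]; exact add_mem hx hy
    | mul x y _ _ hx hy => rw [map_mul]; exact mul_mem hx hy
    | star x _ hx => rw [map_star]; exact star_mem hx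
  have h2 : y ∈ closure (Set.range (mk R hR)) :=
    (universalSeminorm R hR).denseRange_toCompl y
  rw [← SetLike.mem_coe, StarSubalgebra.topologicalClosure_coe]
  refine closure_mono ?_ h2
  rintro _ ⟨x, rfl⟩
  exact h1 x

end UniversalCStar

end Universal

/-! ### Quantum automorphism groups of colored graphs -/

section Qut

variable {V : Type u} {C : Type v} [Fintype V]

/-- The relators of the quantum automorphism group of the graph `X` with vertex coloring `c`;
the generator with index `(i, j)` is the entry `u i j` of the fundamental representation. -/
inductive QutRel (X : SimpleGraph V) (c : V → C) : FreeStarAlgebra (V × V) → Prop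
  | star (i j : V) :
      QutRel X c (star (FreeStarAlgebra.ι (i, j)) - FreeStarAlgebra.ι (i, j))
  | idem (i j : V) :
      QutRel X c (FreeStarAlgebra.ι (i, j) * FreeStarAlgebra.ι (i, j) - FreeStarAlgebra.ι (i, j))
  | row (i : V) : QutRel X c (∑ k, FreeStarAlgebra.ι (i, k) - 1)
  | col (j : V) : QutRel X c (∑ k, FreeStarAlgebra.ι (k, j) - 1)
  | adj (i j k l : V) (h : (X.Adj i k ∧ ¬ X.Adj j l) ∨ (¬ X.Adj i k ∧ X.Adj j l)) :
      QutRel X c (FreeStarAlgebra.ι (i, j) * FreeStarAlgebra.ι (k, l))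
  | color (i j : V) (h : c i ≠ c j) : QutRel X c (FreeStarAlgebra.ι (i, j))

/-- The set of relators of `Qut_c(X)`. -/
def qutRelators (X : SimpleGraph V) (c : V → C) : Set (FreeStarAlgebra (V × V)) :=
  {r | QutRel X c r}

/-- The family `v` of elements of a `*`-algebra satisfies the relations of the quantum automorphism
group of the colored graph `(X, c)`. -/
structure IsQutFamily (X : SimpleGraph V) (c : V → C) {B : Type*} [Ring B] [StarRing B]
    (v : V → V → B) : Prop where
  star_eq : ∀ i j, star (v i j) = v i j
  idem : ∀ i j, v i j * v i j = v i j
  row : ∀ i, ∑ k, v i k = 1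
  col : ∀ j, ∑ k, v k j = 1
  adj : ∀ i j k l, (X.Adj i k ∧ ¬ X.Adj j l) ∨ (¬ X.Adj i k ∧ X.Adj j l) → v i j * v k l = 0
  color : ∀ i j, c i ≠ c j → v i j = 0

theorem lift_qutRel_iff {X : SimpleGraph V} {c : V → C} {B : Type*} [Ring B] [StarRing B]
    [Algebra ℂ B] [StarModule ℂ B] (f : V × V → B) :
    (∀ r ∈ qutRelators X c, FreeStarAlgebra.lift f r = 0) ↔
      IsQutFamily X c fun i j => f (i, j) := by
  constructor
  · intro h
    have h' (r) (hr : QutRel X c r) : FreeStarAlgebra.lift f r = 0 := h r hr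
    exact
      { star_eq := fun i j => by simpa [map_star, sub_eq_zero] using h' _ (.star i j)
        idem := fun i j => by simpa [sub_eq_zero] using h' _ (.idem i j)
        row := fun i => by simpa [sub_eq_zero] using h' _ (.row i)
        col := fun j => by simpa [sub_eq_zero] using h' _ (.col j)
        adj := fun i j k l hh => by simpa using h' _ (.adj i j k l hh)
        color := fun i j hh => by simpa using h' _ (.color i j hh) }
  · rintro h _ (⟨i, j⟩ | ⟨i, j⟩ | i | j | ⟨i, j, k, l, hh⟩ | ⟨i, j, hh⟩)
    · simpa [map_star, sub_eq_zero] using h.star_eq i j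
    · simpa [sub_eq_zero] using h.idem i j
    · simpa [sub_eq_zero] using h.row i
    · simpa [sub_eq_zero] using h.col j
    · simpa using h.adj i j k l hh
    · simpa using h.color i j hh

theorem isBoundedRel_qutRel (X : SimpleGraph V) (c : V → C) :
    IsBoundedRel (qutRelators X c) := by
  rintro ⟨i, j⟩
  refine ⟨1, ?_⟩
  rintro _ ⟨⟨p, hp⟩, rfl⟩
  change p (FreeStarAlgebra.ι (i, j)) ≤ 1
  have h1 : p (star (FreeStarAlgebra.ι (i, j)) - FreeStarAlgebra.ι (i, j)) = 0 := hp _ (.star i j)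
  have h2 : p (FreeStarAlgebra.ι (i, j) * FreeStarAlgebra.ι (i, j) - FreeStarAlgebra.ι (i, j)) = 0 :=
    hp _ (.idem i j)
  have h3 := p.star_mul_self (FreeStarAlgebra.ι (i, j))
  set a : FreeStarAlgebra (V × V) := FreeStarAlgebra.ι (i, j) with ha
  have h4 : star a * a = (star a - a) * a + (a * a - a) + a := by noncomm_ring
  have h5 : p (star a * a) ≤ p a := by
    rw [h4]
    refine (map_add_le_add p.toSeminorm _ _).trans ?_
    refine (add_le_add_left (map_add_le_add p.toSeminorm _ _) _).trans ?_
    have h6 := p.mul_le (star a - a) a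
    rw [h1, zero_mul] at h6
    rw [h2]
    linarith
  rw [h3] at h5
  by_contra hlt
  push Not at hlt
  nlinarith

/-- `C(Qut_c(X))`: the universal `C*`-algebra of the colored graph `(X, c)`. -/
abbrev QutAlgebra (X : SimpleGraph V) (c : V → C) : Type u :=
  UniversalCStar (qutRelators X c) (isBoundedRel_qutRel X c)

variable (X : SimpleGraph V) (c : V → C)

/-- The fundamental representation of `Qut_c(X)`. -/
def qutU (i j : V) : QutAlgebra X c := UniversalCStar.gen _ _ (i, j)

theorem isQutFamily_qutU : IsQutFamily X c (qutU X c) := by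
  have h (r) (hr : QutRel X c r) :
      UniversalCStar.mk _ (isBoundedRel_qutRel X c) r = 0 := UniversalCStar.mk_rel hr
  exact
    { star_eq := fun i j => by simpa [map_star, sub_eq_zero] using! h _ (.star i j)
      idem := fun i j => by simpa [sub_eq_zero] using! h _ (.idem i j)
      row := fun i => by simpa [sub_eq_zero] using! h _ (.row i)
      col := fun j => by simpa [sub_eq_zero] using! h _ (.col j)
      adj := fun i j k l hh => by simpa using! h _ (.adj i j k l hh)
      color := fun i j hh => by simpa using! h _ (.color i j hh) }

variable {X c}

/-- The universal property of `C(Qut_c(X))`. -/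
def qutLift {B : Type*} [CStarAlgebra B] (v : V → V → B) (hv : IsQutFamily X c v) :
    QutAlgebra X c →⋆ₐ[ℂ] B :=
  UniversalCStar.lift (fun ij => v ij.1 ij.2) ((lift_qutRel_iff _).mpr hv)

theorem qutLift_qutU {B : Type*} [CStarAlgebra B] (v : V → V → B) (hv : IsQutFamily X c v)
    (i j : V) : qutLift v hv (qutU X c i j) = v i j :=
  UniversalCStar.lift_gen ..

/-- Projections in a `C*`-algebra with sum `1` are mutually orthogonal. -/
theorem proj_orthogonal {B : Type*} [CStarAlgebra B] (e : V → B) (hs : ∀ i, star (e i) = e i)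
    (hi : ∀ i, e i * e i = e i) (h1 : ∑ i, e i = 1) {i j : V} (hij : i ≠ j) :
    e i * e j = 0 := by
  classical
  let _ : PartialOrder B := CStarAlgebra.spectralOrder B
  have _ : StarOrderedRing B := CStarAlgebra.spectralOrderedRing B
  have h2 : ∑ k ∈ Finset.univ.erase j, star (e k * e j) * (e k * e j) = 0 := by
    have h3 (k : V) : star (e k * e j) * (e k * e j) = e j * e k * e j := by
      rw [star_mul, hs, hs, mul_assoc, ← mul_assoc (e k), hi, mul_assoc]
    have h4 : ∑ k, star (e k * e j) * (e k * e j) = e j := by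
      simp_rw [h3, ← Finset.sum_mul, ← Finset.mul_sum, h1, mul_one, hi]
    rw [← Finset.add_sum_erase _ _ (Finset.mem_univ j), h3, hi, hi] at h4
    exact add_eq_left.mp h4
  have h5 := (Finset.sum_eq_zero_iff_of_nonneg (fun k _ => star_mul_self_nonneg _)).mp h2 i
    (Finset.mem_erase.mpr ⟨hij, Finset.mem_univ i⟩)
  exact CStarRing.star_mul_self_eq_zero_iff _ |>.mp h5

namespace IsQutFamily

variable {B : Type*} [CStarAlgebra B] {v : V → V → B}

theorem row_orth (hv : IsQutFamily X c v) (i : V) {j k : V} (h : j ≠ k) :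
    v i j * v i k = 0 :=
  proj_orthogonal (v i) (hv.star_eq i) (hv.idem i) (hv.row i) h

theorem col_orth (hv : IsQutFamily X c v) (j : V) {i k : V} (h : i ≠ k) :
    v i j * v k j = 0 :=
  proj_orthogonal (fun i => v i j) (fun i => hv.star_eq i j) (fun i => hv.idem i j) (hv.col j) h

theorem isUnit [DecidableEq V] (hv : IsQutFamily X c v) : IsUnit (Matrix.of v) := by
  refine ⟨⟨Matrix.of v, (Matrix.of v).transpose, ?_, ?_⟩, rfl⟩
  · ext i j
    rw [Matrix.mul_apply]
    simp only [Matrix.of_apply, Matrix.transpose_apply]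
    rcases eq_or_ne i j with rfl | h
    · simp [hv.idem, hv.row]
    · rw [Matrix.one_apply_ne h]
      exact Finset.sum_eq_zero fun k _ => hv.col_orth k h
  · ext i j
    rw [Matrix.mul_apply]
    simp only [Matrix.of_apply, Matrix.transpose_apply]
    rcases eq_or_ne i j with rfl | h
    · simp [hv.idem, hv.col]
    · rw [Matrix.one_apply_ne h]
      exact Finset.sum_eq_zero fun k _ => hv.row_orth k h

end IsQutFamily

section minTmul

variable {A : Type u} {B : Type v} [CStarAlgebra A] [CStarAlgebra B]

theorem minTmul_mul (a a' : A) (b b' : B) :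
    minTmul a b * minTmul a' b' = minTmul (a * a') (b * b') := by
  simp only [minTmul, ← map_mul, Algebra.TensorProduct.tmul_mul_tmul]

theorem star_minTmul (a : A) (b : B) : star (minTmul a b) = minTmul (star a) (star b) := by
  simp only [minTmul, ← map_star, TensorProduct.star_tmul]

theorem minTmul_one_one : minTmul (1 : A) (1 : B) = 1 :=
  map_one (spatialNorm A B).toCompl

theorem minTmul_zero_left (b : B) : minTmul (0 : A) b = 0 := by
  simp [minTmul]

theorem minTmul_zero_right (a : A) : minTmul a (0 : B) = 0 := by
  simp [minTmul]

theorem minTmul_sum_left {n : Type*} (s : Finset n) (f : n → A) (b : B) :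
    minTmul (∑ i ∈ s, f i) b = ∑ i ∈ s, minTmul (f i) b := by
  simp [minTmul, TensorProduct.sum_tmul]

theorem minTmul_sum_right {n : Type*} (s : Finset n) (a : A) (f : n → B) :
    minTmul a (∑ i ∈ s, f i) = ∑ i ∈ s, minTmul a (f i) := by
  simp [minTmul, TensorProduct.tmul_sum]

/-- The elementary tensor of two nonzero projections is nonzero. -/
theorem minTmul_ne_zero {p : A} {q : B} (hp : star p = p) (hpp : p * p = p) (p0 : p ≠ 0)
    (hq : star q = q) (hqq : q * q = q) (q0 : q ≠ 0) : minTmul p q ≠ 0 := by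
  obtain ⟨H, _, _, _, π, hπ⟩ := exists_rep_ne_zero p hp hpp p0
  obtain ⟨K, _, _, _, ρ, hρ⟩ := exists_rep_ne_zero q hq hqq q0
  obtain ⟨x, hx⟩ := DFunLike.ne_iff.mp hπ
  obtain ⟨y, hy⟩ := DFunLike.ne_iff.mp hρ
  let π' : HilbertRep A := ⟨H, π⟩
  let ρ' : HilbertRep B := ⟨K, ρ⟩
  intro h
  have h1 : ‖tensorRep π' ρ' (p ⊗ₜ q)‖ ≤ 0 := by
    refine (CStarSeminorm.le_sup (p := CStarSeminorm.ofStarAlgHom (tensorRep π' ρ'))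
      spatial_bdd ⟨π', ρ', rfl⟩ (p ⊗ₜ q)).trans ?_
    exact (((spatialNorm A B).norm_toCompl (p ⊗ₜ q)).symm.trans (norm_eq_zero.mpr h)).le
  have h2 : tensorRep π' ρ' (p ⊗ₜ q) = 0 := norm_le_zero_iff.mp h1
  rw [tensorRep_tmul] at h2
  have h3 := tensorOp_of_tmul (π'.hom p) (ρ'.hom q) x y
  rw [h2] at h3
  have h4 := congrArg norm h3
  rw [LinearIsometry.norm_map, TensorProduct.norm_tmul] at h4
  have h5 : ‖π'.hom p x‖ * ‖ρ'.hom q y‖ = 0 := by rw [← h4]; exact norm_zero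
  rcases mul_eq_zero.mp h5 with h6 | h6
  · exact hx (norm_eq_zero.mp h6)
  · exact hy (norm_eq_zero.mp h6)

end minTmul

/-- The products `∑ k, v i k ⊗ w k j` again satisfy the relations. -/
theorem IsQutFamily.comul {A : Type*} {B : Type*} [CStarAlgebra A] [CStarAlgebra B]
    {v : V → V → A} {w : V → V → B} (hv : IsQutFamily X c v) (hw : IsQutFamily X c w) :
    IsQutFamily X c fun i j => ∑ k, minTmul (v i k) (w k j) where
  star_eq i j := by simp only [star_sum, star_minTmul, hv.star_eq, hw.star_eq]
  idem i j := by
    classical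
    simp only [Finset.sum_mul, Finset.mul_sum, minTmul_mul]
    refine Finset.sum_congr rfl fun k _ => ?_
    rw [Finset.sum_eq_single k]
    · rw [hv.idem, hw.idem]
    · intro l _ hl
      rw [hv.row_orth i hl, minTmul_zero_left]
    · simp
  row i := by
    rw [Finset.sum_comm]
    simp only [← minTmul_sum_right, hw.row, ← minTmul_sum_left, hv.row, minTmul_one_one]
  col j := by
    rw [Finset.sum_comm]
    simp only [← minTmul_sum_left, hv.col, ← minTmul_sum_right, hw.col, minTmul_one_one]
  adj i j k l h := by
    simp only [Finset.sum_mul, Finset.mul_sum, minTmul_mul]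
    refine Finset.sum_eq_zero fun b _ => Finset.sum_eq_zero fun a _ => ?_
    by_cases hab : X.Adj a b
    · rcases h with h | h
      · rw [hw.adj a j b l (Or.inl ⟨hab, h.2⟩), minTmul_zero_right]
      · rw [hv.adj i a k b (Or.inr ⟨h.1, hab⟩), minTmul_zero_left]
    · rcases h with h | h
      · rw [hv.adj i a k b (Or.inl ⟨h.1, hab⟩), minTmul_zero_left]
      · rw [hw.adj a j b l (Or.inr ⟨hab, h.2⟩), minTmul_zero_right]
  color i j h := by
    refine Finset.sum_eq_zero fun k _ => ?_
    by_cases hk : c i = c k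
    · rw [hw.color k j (fun e => h (hk.trans e)), minTmul_zero_right]
    · rw [hv.color i k hk, minTmul_zero_left]

variable (X c)

/-- The comultiplication of `Qut_c(X)`. -/
def qutComul : QutAlgebra X c →⋆ₐ[ℂ] MinTensor (QutAlgebra X c) (QutAlgebra X c) :=
  qutLift _ ((isQutFamily_qutU X c).comul (isQutFamily_qutU X c))

/-- The quantum automorphism group `Qut_c(X)` of the graph `X` with vertex coloring `c`. -/
def Qut [DecidableEq V] : CompactMatrixQuantumGroup.{u} V where
  algebra := QutAlgebra X c
  u := Matrix.of (qutU X c)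
  generates := UniversalCStar.generates
  isUnit_u := (isQutFamily_qutU X c).isUnit
  isUnit_u_star := by
    have h : (Matrix.of (qutU X c)).map star = Matrix.of (qutU X c) := by
      ext i j
      exact (isQutFamily_qutU X c).star_eq i j
    rw [h]
    exact (isQutFamily_qutU X c).isUnit
  comul := qutComul X c
  comul_u i j := qutLift_qutU _ _ i j

theorem qutU_self_ne_zero (i : V) : qutU X c i i ≠ 0 := by
  classical
  have hv : IsQutFamily X c (fun i j : V => if i = j then (1 : ℂ) else 0) :=
    { star_eq := fun i j => by split_ifs <;> simp
      idem := fun i j => by split_ifs <;> simp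
      row := fun i => by simp
      col := fun j => by simp
      adj := fun i j k l h => by
        by_cases h1 : i = j <;> by_cases h2 : k = l
        · subst h1 h2; tauto
        all_goals simp [h1, h2]
      color := fun i j h => by
        rw [if_neg]
        rintro rfl
        exact h rfl }
  intro h
  have := qutLift_qutU _ hv i i
  rw [h, map_zero] at this
  simp at this

theorem qutU_symm {i j : V} (h : qutU X c i j ≠ 0) : qutU X c j i ≠ 0 := by
  have hu := isQutFamily_qutU X c
  have hv : IsQutFamily X c (fun i j : V => MulOpposite.op (qutU X c j i)) :=
    { star_eq := fun i j => by rw [← MulOpposite.op_star, hu.star_eq]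
      idem := fun i j => by rw [← MulOpposite.op_mul, hu.idem]
      row := fun i => by rw [← Finset.op_sum, hu.col, MulOpposite.op_one]
      col := fun j => by rw [← Finset.op_sum, hu.row, MulOpposite.op_one]
      adj := fun i j k l h => by
        rw [← MulOpposite.op_mul, hu.adj l k j i, MulOpposite.op_zero]
        rw [X.adj_comm l j, X.adj_comm k i]
        tauto
      color := fun i j h => by rw [hu.color j i (Ne.symm h), MulOpposite.op_zero] }
  intro h0
  have h1 := qutLift_qutU _ hv j i
  rw [h0, map_zero] at h1
  exact h (MulOpposite.op_injective h1.symm)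

theorem qutU_trans {i j k : V} (hij : qutU X c i j ≠ 0) (hjk : qutU X c j k ≠ 0) :
    qutU X c i k ≠ 0 := by
  have hu := isQutFamily_qutU X c
  intro h
  have h1 : ∑ l, minTmul (qutU X c i l) (qutU X c l k) = 0 := by
    rw [← qutLift_qutU _ (hu.comul hu) i k, h, map_zero]
  have h2 : minTmul (qutU X c i j) 1 * ∑ l, minTmul (qutU X c i l) (qutU X c l k) =
      minTmul (qutU X c i j) (qutU X c j k) := by
    classical
    simp only [Finset.mul_sum, minTmul_mul, one_mul]
    rw [Finset.sum_eq_single j]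
    · rw [hu.idem]
    · intro l _ hl
      rw [hu.row_orth i hl.symm, minTmul_zero_left]
    · simp
  rw [h1, mul_zero] at h2
  exact minTmul_ne_zero (hu.star_eq i j) (hu.idem i j) hij (hu.star_eq j k) (hu.idem j k) hjk
    h2.symm

/-- The equivalence relation `i ∼ j ↔ u i j ≠ 0`, whose classes are the quantum orbits. -/
def quantumOrbitSetoid : Setoid V where
  r i j := qutU X c i j ≠ 0
  iseqv := ⟨qutU_self_ne_zero X c, qutU_symm X c, qutU_trans X c⟩

/-- `S` is a union of quantum orbits of `(X, c)`, that is, of orbits of `Qut_c(X)`. -/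
def IsUnionOfQuantumOrbits (S : Set V) : Prop :=
  ∃ O ⊆ (quantumOrbitSetoid X c).classes, S = ⋃₀ O

end Qut

/-! ### Modifications of colored graphs -/

section Modifications

variable {V : Type u} {C : Type v}

/-- `S` is a union of color classes of the coloring `c`. -/
def IsUnionOfColorClasses (c : V → C) (S : Set V) : Prop := ∃ K : Set C, S = c ⁻¹' K

/-- `S` is monochromatic for the coloring `c`. -/
def IsMonochromatic (c : V → C) (S : Set V) : Prop := ∀ v ∈ S, ∀ w ∈ S, c v = c w

/-- Add all edges between distinct vertices of `S`. -/
def completeOn (X : SimpleGraph V) (S : Set V) : SimpleGraph V :=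
  X ⊔ SimpleGraph.fromRel fun v w => v ∈ S ∧ w ∈ S

/-- Add all edges between a vertex of `S` and a vertex of `T`. -/
def joinBetween (X : SimpleGraph V) (S T : Set V) : SimpleGraph V :=
  X ⊔ SimpleGraph.fromRel fun v w => v ∈ S ∧ w ∈ T

open Classical in
/-- Give all vertices of `S` the color `a`. -/
def recolor (c : V → C) (S : Set V) (a : C) : V → C := fun v => if v ∈ S then a else c v

/-- Add one isolated vertex (the vertex `none`). -/
def addIsolated (X : SimpleGraph V) : SimpleGraph (Option V) := X.map Function.Embedding.some

/-- Extend a coloring by giving the added vertex the color `a`. -/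
def extendColoring (c : V → C) (a : C) : Option V → C := fun v => v.elim a c

end Modifications

end

/-!
If `u i j * u k l ≠ 0` for the fundamental representation `u`, then `c i = c j`, `c k = c l` and
`i = k ↔ j = l`. So a graph `Z` whose adjacency depends only on the colors of the two endpoints
satisfies its adjacency relations automatically, and exchanging edges and non-edges of `X` along `Z`
gives a graph `X ∆ Z` with the same relations as `X`; over an independent set, adding the edges
of `Z` is such an exchange. A coloring that refines the old one and is constant on quantum orbits
imposes relations that hold already. Finally, a vertex with a color of its own is fixed by `u`, so
that an isolated one contributes nothing.
-/

namespace UniversalCStar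

theorem hom_ext {X B : Type*} [CStarAlgebra B] {R : Set (FreeStarAlgebra X)} {hR : IsBoundedRel R}
    {φ ψ : UniversalCStar R hR →⋆ₐ[ℂ] B} (h : ∀ x, φ (gen R hR x) = ψ (gen R hR x)) : φ = ψ := by
  have agree_on_free : φ.comp (mk R hR) = ψ.comp (mk R hR) :=
    StarAlgHom.ext_of_adjoin_eq_top FreeStarAlgebra.adjoin_ι (Set.forall_mem_range.mpr h)
  exact CStarSeminorm.hom_ext (universalSeminorm R hR) (DFunLike.congr_fun agree_on_free)

end UniversalCStar

namespace IsQutFamily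

section Ring

variable {V : Type*} [Fintype V] {C D : Type*} {X Y : SimpleGraph V} {c : V → C} {d : V → D}
  {B : Type*} [Ring B] [StarRing B] {v : V → V → B}

theorem color_eq_of_ne_zero (hv : IsQutFamily X c v) {i j : V} (h : v i j ≠ 0) : c i = c j :=
  not_not.mp (mt (hv.color i j) h)

theorem adj_iff_of_mul_ne_zero (hv : IsQutFamily X c v) {i j k l : V} (h : v i j * v k l ≠ 0) :
    X.Adj i k ↔ X.Adj j l := by
  have := mt (hv.adj i j k l) h
  tauto

theorem of_preserves (hv : IsQutFamily X c v)
    (hadj : ∀ i j k l, v i j * v k l ≠ 0 → (Y.Adj i k ↔ Y.Adj j l))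
    (hcolor : ∀ i j, v i j ≠ 0 → d i = d j) : IsQutFamily Y d v where
  star_eq := hv.star_eq
  idem := hv.idem
  row := hv.row
  col := hv.col
  adj i j k l h := by
    by_contra hne
    have := hadj i j k l hne
    tauto
  color i j h := not_not.mp (mt (hcolor i j) h)

end Ring

theorem eq_iff_of_mul_ne_zero {V : Type*} [Fintype V] {C : Type*} {X : SimpleGraph V} {c : V → C}
    {B : Type*} [CStarAlgebra B] {v : V → V → B} (hv : IsQutFamily X c v) {i j k l : V}
    (h : v i j * v k l ≠ 0) : i = k ↔ j = l := by
  constructor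
  · rintro rfl
    exact not_not.mp (mt (hv.row_orth i) h)
  · rintro rfl
    exact not_not.mp (mt (hv.col_orth j) h)

end IsQutFamily

namespace Qut

universe u

variable {V W : Type u} [Fintype V] [DecidableEq V] [Fintype W] [DecidableEq W] {C D : Type*}
  {X Y : SimpleGraph V} {c : V → C} {d : V → D} {Z : SimpleGraph W} {e : W → D}

theorem isomorphic_of_families (v : V → V → QutAlgebra Z e) (hv : IsQutFamily X c v)
    (w : W → W → QutAlgebra X c) (hw : IsQutFamily Z e w)
    (hwv : ∀ i j, qutLift w hw (v i j) = qutU X c i j)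
    (hvw : ∀ i j, qutLift v hv (w i j) = qutU Z e i j)
    (hcomul : ∀ i j, qutComul Z e (v i j) = ∑ k, minTmul (v i k) (v k j)) :
    (Qut X c).Isomorphic (Qut Z e) := by
  have left_inv : (qutLift w hw).comp (qutLift v hv) = StarAlgHom.id ℂ _ :=
    UniversalCStar.hom_ext fun (i, j) => (congrArg _ (qutLift_qutU v hv i j)).trans (hwv i j)
  have right_inv : (qutLift v hv).comp (qutLift w hw) = StarAlgHom.id ℂ _ :=
    UniversalCStar.hom_ext fun (i, j) => (congrArg _ (qutLift_qutU w hw i j)).trans (hvw i j)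
  have intertwines : (minTensorMap (qutLift v hv) (qutLift v hv)).comp (qutComul X c) =
      (qutComul Z e).comp (qutLift v hv) := UniversalCStar.hom_ext fun (i, j) => calc
    minTensorMap (qutLift v hv) (qutLift v hv) (qutComul X c (qutU X c i j))
    _ = minTensorMap (qutLift v hv) (qutLift v hv) (∑ k, minTmul (qutU X c i k) (qutU X c k j)) :=
      congrArg _ ((Qut X c).comul_u i j)
    _ = ∑ k, minTmul (v i k) (v k j) := by
      simp only [map_sum, minTensorMap_tmul, qutLift_qutU]
    _ = qutComul Z e (qutLift v hv (qutU X c i j)) := by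
      rw [qutLift_qutU, hcomul]
  exact ⟨.ofStarAlgHom (qutLift v hv) (qutLift w hw) left_inv right_inv,
    DFunLike.congr_fun intertwines⟩

theorem isomorphic_of_isQutFamily (hX : IsQutFamily X c (qutU Y d))
    (hY : IsQutFamily Y d (qutU X c)) : (Qut X c).Isomorphic (Qut Y d) :=
  isomorphic_of_families _ hX _ hY (fun _ _ => qutLift_qutU ..) (fun _ _ => qutLift_qutU ..)
    (Qut Y d).comul_u

end Qut

/-! ### Changing the edges -/

section Edges

open scoped symmDiff

/-- Whether two distinct vertices are adjacent in `Z` depends only on their colors. Pairs that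
are not distinct are left out, since a simple graph has no loops. -/
def AdjDependsOnColors {V C : Type*} (c : V → C) (Z : SimpleGraph V) : Prop :=
  ∀ ⦃i j k l⦄, c i = c j → c k = c l → i ≠ k → j ≠ l → (Z.Adj i k ↔ Z.Adj j l)

theorem AdjDependsOnColors.adj_iff_of_mul_ne_zero {V : Type*} [Fintype V] {C : Type*}
    {X Z : SimpleGraph V} {c : V → C} {B : Type*} [CStarAlgebra B] {v : V → V → B}
    (hZ : AdjDependsOnColors c Z) (hv : IsQutFamily X c v) {i j k l : V}
    (h : v i j * v k l ≠ 0) : Z.Adj i k ↔ Z.Adj j l := by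
  have hij : c i = c j := hv.color_eq_of_ne_zero (left_ne_zero_of_mul h)
  have hkl : c k = c l := hv.color_eq_of_ne_zero (right_ne_zero_of_mul h)
  have heq : i = k ↔ j = l := hv.eq_iff_of_mul_ne_zero h
  by_cases hik : i = k
  · simp only [hik, heq.mp hik, SimpleGraph.irrefl]
  · exact hZ hij hkl hik (mt heq.mpr hik)

theorem IsQutFamily.symmDiff {V : Type*} [Fintype V] {C : Type*} {X Z : SimpleGraph V} {c : V → C}
    {B : Type*} [CStarAlgebra B] {v : V → V → B} (hv : IsQutFamily X c v)
    (hZ : AdjDependsOnColors c Z) : IsQutFamily (X ∆ Z) c v :=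
  hv.of_preserves
    (fun i j k l h => by
      simp only [symmDiff_def, SimpleGraph.sup_adj, SimpleGraph.sdiff_adj,
        hv.adj_iff_of_mul_ne_zero h, hZ.adj_iff_of_mul_ne_zero hv h])
    fun _ _ => hv.color_eq_of_ne_zero

theorem Qut.isomorphic_symmDiff {V : Type*} [Fintype V] [DecidableEq V] {C : Type*}
    (X : SimpleGraph V) {Z : SimpleGraph V} {c : V → C} (hZ : AdjDependsOnColors c Z) :
    (Qut X c).Isomorphic (Qut (X ∆ Z) c) := by
  have hX : IsQutFamily (X ∆ Z ∆ Z) c (qutU (X ∆ Z) c) :=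
    (isQutFamily_qutU (X ∆ Z) c).symmDiff hZ
  rw [symmDiff_symmDiff_cancel_right] at hX
  exact isomorphic_of_isQutFamily hX ((isQutFamily_qutU X c).symmDiff hZ)

variable {V C : Type*} {X : SimpleGraph V} {c : V → C} {S T : Set V}

theorem joinBetween_eq_symmDiff (h : X.IsIndepSet (S ∪ T)) :
    joinBetween X S T = X ∆ (⊤ : SimpleGraph V).between S T := by
  have disjoint : Disjoint X ((⊤ : SimpleGraph V).between S T) :=
    SimpleGraph.disjoint_left.mpr fun v w hX hST => by
      rcases hST.2 with ⟨hv, hw⟩ | ⟨hv, hw⟩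
      · exact h (.inl hv) (.inr hw) hX.ne hX
      · exact h (.inr hv) (.inl hw) hX.ne hX
  rw [disjoint.symmDiff_eq_sup]
  ext v w
  simp only [joinBetween, SimpleGraph.sup_adj, SimpleGraph.fromRel_adj, SimpleGraph.between_adj,
    SimpleGraph.top_adj, and_comm (a := w ∈ S)]

theorem completeOn_eq_symmDiff (h : X.IsIndepSet S) :
    completeOn X S = X ∆ (⊤ : SimpleGraph V).between S S :=
  joinBetween_eq_symmDiff (by rwa [Set.union_self])

theorem IsUnionOfColorClasses.mem_iff (hS : IsUnionOfColorClasses c S) {i j : V} (h : c i = c j) :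
    i ∈ S ↔ j ∈ S := by
  obtain ⟨K, rfl⟩ := hS
  simp only [Set.mem_preimage, h]

theorem IsUnionOfColorClasses.adjDependsOnColors_between (hS : IsUnionOfColorClasses c S)
    (hT : IsUnionOfColorClasses c T) :
    AdjDependsOnColors c ((⊤ : SimpleGraph V).between S T) := by
  intro i j k l hij hkl hik hjl
  simp only [SimpleGraph.between_adj, SimpleGraph.top_adj, ne_eq, hik, hjl, hS.mem_iff hij,
    hS.mem_iff hkl, hT.mem_iff hij, hT.mem_iff hkl]

end Edges

/-! ### Changing the colors -/

theorem Qut.isomorphic_of_color_refinement {V : Type*} [Fintype V] [DecidableEq V] {C D : Type*}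
    {X : SimpleGraph V} {c : V → C} {d : V → D} (hdc : ∀ i j, d i = d j → c i = c j)
    (horbit : ∀ i j, qutU X c i j ≠ 0 → d i = d j) : (Qut X c).Isomorphic (Qut X d) :=
  have hc := isQutFamily_qutU X c
  have hd := isQutFamily_qutU X d
  isomorphic_of_isQutFamily
    (hd.of_preserves (fun _ _ _ _ => hd.adj_iff_of_mul_ne_zero)
      fun i j h => hdc i j (hd.color_eq_of_ne_zero h))
    (hc.of_preserves (fun _ _ _ _ => hc.adj_iff_of_mul_ne_zero) horbit)

theorem IsUnionOfQuantumOrbits.mem_iff_of_qutU_ne_zero {V : Type*} [Fintype V] {C : Type*}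
    {X : SimpleGraph V} {c : V → C} {S : Set V} (hS : IsUnionOfQuantumOrbits X c S) {i j : V}
    (h : qutU X c i j ≠ 0) : i ∈ S ↔ j ∈ S := by
  obtain ⟨O, hO, rfl⟩ := hS
  simp only [Set.mem_sUnion]
  refine exists_congr fun s => and_congr_right fun hs => ?_
  obtain ⟨y, rfl⟩ := hO hs
  exact ⟨fun hi => (quantumOrbitSetoid X c).trans' (qutU_symm X c h) hi,
    fun hj => (quantumOrbitSetoid X c).trans' h hj⟩

section Recolor

variable {V C : Type*} {c : V → C} {S : Set V} {a : C} {i j : V}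

theorem IsMonochromatic.eq_of_recolor_eq (hS : IsMonochromatic c S) (ha : ∀ v ∉ S, c v ≠ a)
    (h : recolor c S a i = recolor c S a j) : c i = c j := by
  by_cases hi : i ∈ S <;> by_cases hj : j ∈ S <;>
    simp only [recolor, hi, hj, if_true, if_false] at h
  · exact hS i hi j hj
  · exact absurd h.symm (ha j hj)
  · exact absurd h (ha i hi)
  · exact h

theorem recolor_eq_of_mem_iff (hS : i ∈ S ↔ j ∈ S) (hc : c i = c j) :
    recolor c S a i = recolor c S a j := by
  classical exact if_congr hS rfl hc

end Recolor

/-! ### Adding a fixed point -/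

section AddIsolated

theorem addIsolated_adj_some {V : Type*} {X : SimpleGraph V} {i k : V} :
    (addIsolated X).Adj (some i) (some k) ↔ X.Adj i k :=
  SimpleGraph.map_adj_apply (f := Function.Embedding.some)

theorem not_addIsolated_adj_none {V : Type*} {X : SimpleGraph V} {k : Option V} :
    ¬ (addIsolated X).Adj none k := by
  rintro ⟨-, _, _, -, h, -⟩
  exact Option.some_ne_none _ h

/-- The block sum of the matrix `v` and the `1 × 1` matrix `1`: the action `v` extended by the
fixed point `none`. -/
def extendByFixedPoint {V A : Type*} [Zero A] [One A] (v : V → V → A) : Option V → Option V → A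
  | none, none => 1
  | some i, some j => v i j
  | _, _ => 0

theorem map_extendByFixedPoint {V A B F : Type*} [Zero A] [One A] [Zero B] [One B] [FunLike F A B]
    [ZeroHomClass F A B] [OneHomClass F A B] (φ : F) (v : V → V → A) :
    ∀ i j, φ (extendByFixedPoint v i j) = extendByFixedPoint (fun i j => φ (v i j)) i j
  | none, none => map_one φ
  | none, some _ => map_zero φ
  | some _, none => map_zero φ
  | some _, some _ => rfl

variable {V : Type*} [Fintype V] {C D : Type*} {X : SimpleGraph V} {c : V → C}
  {d : Option V → D} {B : Type*} [Ring B] [StarRing B]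

theorem IsQutFamily.extend {v : V → V → B} (hv : IsQutFamily X c v)
    (hcd : ∀ i j, c i = c j → d (some i) = d (some j)) :
    IsQutFamily (addIsolated X) d (extendByFixedPoint v) where
  star_eq
    | none, none => star_one _
    | none, some _ => star_zero _
    | some _, none => star_zero _
    | some i, some j => hv.star_eq i j
  idem
    | none, none => one_mul _
    | none, some _ => zero_mul _
    | some _, none => zero_mul _
    | some i, some j => hv.idem i j
  row
    | none => by simp [Fintype.sum_option, extendByFixedPoint]
    | some i => by simp [Fintype.sum_option, extendByFixedPoint, hv.row]
  col
    | none => by simp [Fintype.sum_option, extendByFixedPoint]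
    | some i => by simp [Fintype.sum_option, extendByFixedPoint, hv.col]
  adj i j k l h := by
    rcases i with _ | i <;> rcases j with _ | j <;> rcases k with _ | k <;> rcases l with _ | l
    case some.some.some.some =>
      exact hv.adj i j k l (by simpa only [addIsolated_adj_some] using h)
    all_goals first
      | exact zero_mul _
      | exact mul_zero _
      | exact absurd h (by simp [not_addIsolated_adj_none, SimpleGraph.adj_comm _ _ none])
  color
    | none, none => fun h => absurd rfl h
    | none, some _ => fun _ => rfl
    | some _, none => fun _ => rfl
    | some i, some j => fun h => hv.color i j (mt (hcd i j) h)

theorem IsQutFamily.of_extend {v : V → V → B}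
    (hv : IsQutFamily (addIsolated X) d (extendByFixedPoint v))
    (hdc : ∀ i j, d (some i) = d (some j) → c i = c j) : IsQutFamily X c v where
  star_eq i j := hv.star_eq (some i) (some j)
  idem i j := hv.idem (some i) (some j)
  row i := by simpa [Fintype.sum_option, extendByFixedPoint] using hv.row (some i)
  col j := by simpa [Fintype.sum_option, extendByFixedPoint] using hv.col (some j)
  adj i j k l h :=
    hv.adj (some i) (some j) (some k) (some l) (by simpa only [addIsolated_adj_some] using h)
  color i j h := hv.color (some i) (some j) (mt (hdc i j) h)

theorem IsQutFamily.eq_extendByFixedPoint {Y : SimpleGraph (Option V)} {v : Option V → Option V → B}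
    (hv : IsQutFamily Y d v) (hd : ∀ i, d (some i) ≠ d none) :
    v = extendByFixedPoint fun i j => v (some i) (some j) := by
  have none_some (j : V) : v none (some j) = 0 := hv.color _ _ (hd j).symm
  funext i j
  rcases i with _ | i <;> rcases j with _ | j
  · simpa [Fintype.sum_option, none_some, extendByFixedPoint] using hv.row none
  · exact none_some j
  · exact hv.color _ _ (hd i)
  · rfl

end AddIsolated

theorem Qut.isomorphic_addIsolated {V : Type*} [Fintype V] [DecidableEq V] {C D : Type*}
    {X : SimpleGraph V} {c : V → C} {d : Option V → D}
    (hdc : ∀ i j, d (some i) = d (some j) ↔ c i = c j) (hd : ∀ i, d (some i) ≠ d none) :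
    (Qut X c).Isomorphic (Qut (addIsolated X) d) := by
  set Y := addIsolated X
  have hu := isQutFamily_qutU Y d
  have hfix := hu.eq_extendByFixedPoint hd
  have hv : IsQutFamily X c fun i j => qutU Y d (some i) (some j) :=
    (hfix ▸ hu).of_extend fun i j => (hdc i j).mp
  have hw : IsQutFamily Y d (extendByFixedPoint (qutU X c)) :=
    (isQutFamily_qutU X c).extend fun i j => (hdc i j).mpr
  refine isomorphic_of_families _ hv _ hw (fun i j => qutLift_qutU _ hw _ _) (fun i j => ?_)
    fun i j => ?_
  · simp only [map_extendByFixedPoint, qutLift_qutU]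
    exact (congrFun₂ hfix i j).symm
  · have some_none : qutU Y d (some i) none = 0 := hu.color _ _ (hd i)
    calc qutComul Y d (qutU Y d (some i) (some j))
      _ = ∑ k, minTmul (qutU Y d (some i) k) (qutU Y d k (some j)) := (Qut Y d).comul_u _ _
      _ = ∑ k, minTmul (qutU Y d (some i) (some k)) (qutU Y d (some k) (some j)) := by
        rw [Fintype.sum_option, some_none, minTmul_zero_left, zero_add]

open scoped symmDiff in
theorem mainTheorem5_general {V : Type*} [Fintype V] [DecidableEq V] {C : Type*}
    (X : SimpleGraph V) (c : V → C) :
    (∀ Z : SimpleGraph V, AdjDependsOnColors c Z → (Qut X c).Isomorphic (Qut (X ∆ Z) c)) ∧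
    (∀ (D : Type*) (d : V → D), (∀ i j, d i = d j → c i = c j) →
      (∀ i j, qutU X c i j ≠ 0 → d i = d j) → (Qut X c).Isomorphic (Qut X d)) ∧
    (∀ (D : Type*) (d : Option V → D), (∀ i j, d (some i) = d (some j) ↔ c i = c j) →
      (∀ i, d (some i) ≠ d none) → (Qut X c).Isomorphic (Qut (addIsolated X) d)) :=
  ⟨fun _ => Qut.isomorphic_symmDiff X, fun _ _ => Qut.isomorphic_of_color_refinement,
    fun _ _ => Qut.isomorphic_addIsolated⟩

theorem mainTheorem5 {V : Type*} [Fintype V] [DecidableEq V] {C : Type*} (X : SimpleGraph V)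
    (c : V → C) :
    -- completing an independent union of color classes to a clique
    (∀ S : Set V, X.IsIndepSet S → IsUnionOfColorClasses c S →
      (Qut X c).Isomorphic (Qut (completeOn X S) c)) ∧
    -- joining two disjoint unions of color classes
    (∀ S T : Set V, Disjoint S T → X.IsIndepSet (S ∪ T) → IsUnionOfColorClasses c S →
      IsUnionOfColorClasses c T → (Qut X c).Isomorphic (Qut (joinBetween X S T) c)) ∧
    -- recoloring a monochromatic union of quantum orbits
    (∀ (D : Type*) (f : C ↪ D) (S : Set V) (a : D), IsMonochromatic c S →
      IsUnionOfQuantumOrbits X c S → (∀ v ∉ S, f (c v) ≠ a) →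
      (Qut X c).Isomorphic (Qut X (recolor (f ∘ c) S a))) ∧
    -- adding an isolated vertex of a new color
    (∀ (D : Type*) (f : C ↪ D) (a : D), (∀ v, f (c v) ≠ a) →
      (Qut X c).Isomorphic (Qut (addIsolated X) (extendColoring (f ∘ c) a))) := by
  obtain ⟨isomorphic_symmDiff, isomorphic_refinement, isomorphic_addIsolated⟩ :=
    mainTheorem5_general X c
  refine ⟨fun S hS hcS => ?_, fun S T _ hST hcS hcT => ?_, fun D f S a hS hO ha => ?_,
    fun D f a ha => ?_⟩
  · rw [completeOn_eq_symmDiff hS]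
    exact isomorphic_symmDiff _ (hcS.adjDependsOnColors_between hcS)
  · rw [joinBetween_eq_symmDiff hST]
    exact isomorphic_symmDiff _ (hcS.adjDependsOnColors_between hcT)
  · have hfS : IsMonochromatic (f ∘ c) S := fun v hv w hw => congrArg f (hS v hv w hw)
    exact isomorphic_refinement D _ (fun i j h => f.injective (hfS.eq_of_recolor_eq ha h))
      fun i j h => recolor_eq_of_mem_iff (hO.mem_iff_of_qutU_ne_zero h)
        (congrArg f ((isQutFamily_qutU X c).color_eq_of_ne_zero h))
  · exact isomorphic_addIsolated D _ (fun _ _ => f.injective.eq_iff) ha
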